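/- Notation. Let $X$ be a finite set, $F$ the free group on $X$, and $\Sigma = X \cup X^{-1}$ the alphabet of free generators and their formal inverses. Each word $w \in \Sigma^*$ represents an element $\hat w$ of $F$ and has a formal inverse $w^{-1} \in \Sigma^*$; the empty word is $\varepsilon$, and $w^r$ is $w$ written backwards. A rational transduction over $\Sigma$ is the set of labels of successful paths (from the initial vertex to a terminal vertex) in a finite directed graph with one initial vertex, some terminal vertices, and edge labels in $(\Sigma\cup\{\varepsilon\})\times(\Sigma\cup\{\varepsilon\})$, where the label of a path is the product in $\Sigma^*\times\Sigma^*$ of the labels of its edges. A language $L \subseteq \Sigma^*$ is linear if $L = \{uv^r \mid (u,v) \in \rho\}$ for some rational transduction $\rho$ over $\Sigma$. A language $L\subseteq\Sigma^*$ of nonempty freely reduced words has significant letters if every $w \in L$ can be written as $w = u_w a_w v_w^{-1}$ with $u_w, v_w\in\Sigma^*$ and $a_w \in \Sigma$ in such a way that for all $w_1, w_2 \in L$ and $\epsilon_1,\epsilon_2 = \pm 1$, free reduction of the product $w_1^{\epsilon_1} w_2^{\epsilon_2} = (u_{w_1}a_{w_1}v_{w_1}^{-1})^{\epsilon_1}(u_{w_2}a_{w_2}v_{w_2}^{-1})^{\epsilon_2}$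 does not affect the letters $a_{w_1}^{\epsilon_1}$ and $a_{w_2}^{\epsilon_2}$, unless the product reduces to $\varepsilon$. A deterministic asynchronous two-tape automaton has finitely many states, each of which reads the next symbol of a fixed one of the two tapes, and a partial transition function; it accepts $(u,v)$ if, started on the tapes $u\$$ and $v\$$ with end-of-tape symbol $\$$, it reads both tapes completely and stops in an accepting state. An asynchronous automatic structure on a group $G$ consists of a finite set $X$ with a surjective homomorphism $\mu : F \to G$, a regular language $C \subseteq \Sigma^*$ such that $w\mapsto\mu(\hat w)$ maps $C$ onto $G$, and for each $x \in \Sigma \cup \{\varepsilon\}$ a deterministic asynchronous two-tape automaton that accepts exactly the pairs $(u,v)$ with $u, v\in C$ and $\mu(\widehat{ux}) = \mu(\hat v)$. It is prefix-closed if every prefix of a word in $C$ is in $C$, and it is with uniqueness if $w\mapsto\mu(\hat w)$ is injective on $C$. Theorem. A group $G$ has a prefix-closed asynchronous automatic structure with uniqueness if and only if there are a finite set $X$, a normal subgroup $N$ of the free group $F$ on $X$ with $G \cong F/N$, and a linear language $L \subseteq \Sigma^*$ of freely reduced words that has significant letters and whose image $\{\hat w \mid w\in L\}$ in $F$ generates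 $N$. -/

import Mathlib

/-! Words over the alphabet of free generators `x` and formal inverses `x⁻¹` (`x : X`) are lists in
`X × Bool`, as in Mathlib's `FreeGroup`: `(x, true)` stands for `x` and `(x, false)` for `x⁻¹`.
`FreeGroup.mk w` is the element represented by `w`, `FreeGroup.invRev w` the formal inverse of `w`,
`FreeGroup.IsReduced w` says that `w` is freely reduced, and `FreeGroup.Red w w'` says that `w'` is
obtained from `w` by cancelling adjacent pairs of inverse letters. -/

/-- A (nondeterministic) automaton over `α × α`: a directed graph whose edge labels are pairs whose
components are letters or empty (`none`), with one initial vertex and a set of terminal vertices. -/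
structure TransductionAutomaton (α : Type*) (σ : Type*) where
  /-- `edge p a b q`: there is an edge from `p` to `q` with label `(a, b)`. -/
  edge : σ → Option α → Option α → σ → Prop
  start : σ
  terminal : Set σ

namespace TransductionAutomaton

variable {α σ : Type*}

/-- `M.Path p q u v`: there is a path from `p` to `q` whose label (the product of the labels of its
edges) is `(u, v)`. -/
inductive Path (M : TransductionAutomaton α σ) : σ → σ → List α → List α → Prop
  | nil (p : σ) : Path M p p [] []
  | cons {p q r : σ} {a b : Option α} {u v : List α} :
      M.edge p a b q → Path M q r u v → Path M p r (a.toList ++ u) (b.toList ++ v)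

/-- The set of labels of successful paths. -/
def accepts (M : TransductionAutomaton α σ) : Set (List α × List α) :=
  {w | ∃ q ∈ M.terminal, M.Path M.start q w.1 w.2}

end TransductionAutomaton

/-- Rational transductions: the binary relations on words accepted by finite automata over
`α × α`. -/
def IsRationalTransduction {α : Type*} (ρ : Set (List α × List α)) : Prop :=
  ∃ (σ : Type) (_ : Finite σ) (M : TransductionAutomaton α σ), M.accepts = ρ

/-- A language is linear if it is `{u vʳ | (u, v) ∈ ρ}` for some rational transduction `ρ`, where
`vʳ` is `v` written backwards. -/
def IsLinearLanguage {α : Type*} (L : Language α) : Prop :=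
  ∃ ρ : Set (List α × List α), IsRationalTransduction ρ ∧
    ∀ w : List α, w ∈ L ↔ ∃ u v : List α, (u, v) ∈ ρ ∧ w = u ++ v.reverse

/-- A word `pre · letter · post` with a distinguished letter. -/
structure MarkedWord (X : Type*) where
  pre : List (X × Bool)
  letter : X × Bool
  post : List (X × Bool)

namespace MarkedWord

variable {X : Type*}

/-- The underlying word. -/
def word (m : MarkedWord X) : List (X × Bool) := m.pre ++ m.letter :: m.post

/-- The formal inverse, with the inverse letter distinguished. -/
def inv (m : MarkedWord X) : MarkedWord X where
  pre := FreeGroup.invRev m.post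
  letter := (m.letter.1, !m.letter.2)
  post := FreeGroup.invRev m.pre

/-- `m.signed true = m` and `m.signed false` is the formal inverse of `m`. -/
def signed (m : MarkedWord X) (ε : Bool) : MarkedWord X := bif ε then m else m.inv

/-- Free reduction of the product of `m₁` and `m₂` does not affect the two distinguished letters:
reducing only the part between these letters already gives a freely reduced word. -/
def Unaffected (m₁ m₂ : MarkedWord X) : Prop :=
  ∃ y : List (X × Bool), FreeGroup.Red (m₁.post ++ m₂.pre) y ∧
    FreeGroup.IsReduced (m₁.pre ++ m₁.letter :: (y ++ m₂.letter :: m₂.post))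

end MarkedWord

/-- `L` is a language of nonempty freely reduced words that has significant letters: one can
distinguish a letter in each word of `L` in such a way that free reduction of a product
`w₁^{±1} w₂^{±1}` with `w₁, w₂ ∈ L` does not affect the distinguished letters, unless the product
reduces to the empty word. -/
structure HasSignificantLetters {X : Type*} (L : Language (X × Bool)) : Prop where
  reduced : ∀ w ∈ L, FreeGroup.IsReduced w
  nil_notMem : [] ∉ L
  letters : ∃ d : List (X × Bool) → MarkedWord X, (∀ w ∈ L, (d w).word = w) ∧
    ∀ w₁ ∈ L, ∀ w₂ ∈ L, ∀ ε₁ ε₂ : Bool,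
      FreeGroup.Red (((d w₁).signed ε₁).word ++ ((d w₂).signed ε₂).word) [] ∨
        ((d w₁).signed ε₁).Unaffected ((d w₂).signed ε₂)

/-- A deterministic asynchronous two-tape automaton. Each state reads from a fixed one of the two
tapes; `step` is a partial transition function, and its input is a letter or the end-of-tape
symbol `none`. -/
structure AsyncAutomaton (α : Type*) (σ : Type*) where
  /-- Does the state read the left tape (or else the right one)? -/
  readsLeft : σ → Bool
  step : σ → Option α → Option σ
  start : σ
  accept : Set σ

namespace AsyncAutomaton

variable {α σ : Type*}

/-- `M.AcceptsFrom s x y`: started in state `s` with `x` and `y` left on the two tapes, `M` reads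
both tapes to their ends and stops in an accepting state. -/
inductive AcceptsFrom (M : AsyncAutomaton α σ) : σ → List (Option α) → List (Option α) → Prop
  | done {s : σ} : s ∈ M.accept → AcceptsFrom M s [] []
  | left {s t : σ} {a : Option α} {x y : List (Option α)} : M.readsLeft s = true →
      M.step s a = some t → AcceptsFrom M t x y → AcceptsFrom M s (a :: x) y
  | right {s t : σ} {a : Option α} {x y : List (Option α)} : M.readsLeft s = false →
      M.step s a = some t → AcceptsFrom M t x y → AcceptsFrom M s x (a :: y)

/-- `M` accepts the pair `(u, v)`; both words are followed by the end-of-tape symbol. -/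
def Accepts (M : AsyncAutomaton α σ) (u v : List α) : Prop :=
  M.AcceptsFrom M.start (u.map some ++ [none]) (v.map some ++ [none])

end AsyncAutomaton

/-- Let `μ : FreeGroup X →* G` be a choice of generators for `G`. The language `C` is the language of
the word acceptor of an asynchronous automatic structure: `C` is regular, `C` maps onto `G`, and for
each `x` that is a letter or empty (`none`) there is a finite asynchronous automaton which accepts
exactly the pairs `(u, v)` with `u, v ∈ C` such that `u x` and `v` represent the same element
of `G`. -/
structure IsAsyncAutomaticStructure {X G : Type*} [Group G] (μ : FreeGroup X →* G)
    (C : Language (X × Bool)) : Prop where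
  regular : C.IsRegular
  onto : ∀ g : G, ∃ w ∈ C, μ (FreeGroup.mk w) = g
  multiplier : ∀ x : Option (X × Bool), ∃ (σ : Type) (_ : Finite σ)
    (M : AsyncAutomaton (X × Bool) σ), ∀ u v : List (X × Bool),
      M.Accepts u v ↔ u ∈ C ∧ v ∈ C ∧ μ (FreeGroup.mk (u ++ x.toList)) = μ (FreeGroup.mk v)

/-- Every prefix of a word of `C` is in `C`. -/
def IsPrefixClosed {α : Type*} (C : Language α) : Prop :=
  ∀ w ∈ C, ∀ u : List α, u <+: w → u ∈ C

/-- `G` has a prefix-closed asynchronous automatic structure with uniqueness, over some finite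
alphabet of generators and their inverses. -/
def HasPrefixClosedAsyncStructureWithUniqueness (G : Type*) [Group G] : Prop :=
  ∃ (X : Type) (_ : Finite X) (μ : FreeGroup X →* G) (C : Language (X × Bool)),
    Function.Surjective μ ∧ IsAsyncAutomaticStructure μ C ∧ IsPrefixClosed C ∧
      ∀ u ∈ C, ∀ v ∈ C, μ (FreeGroup.mk u) = μ (FreeGroup.mk v) → u = v

/-! From a structure to a language: let `C` be the prefix-closed set of unique representatives. By
Schreier's method the kernel is generated by the words `u a v⁻¹` with `u`, `v` in `C` and `ua = v`
in `G`, where `ua` and `va⁻¹` are not in `C`. Cancellation in a nontrivial product of two of them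
stops before a letter `a` is reached, since otherwise prefix closure would put some `ua` or `va⁻¹`
into `C` (`IsSchreierTriple.unaffected`). A transducer that simulates the multiplier automata and
writes the right tape inverted produces these words.

From a language to a structure: let `S` be `L` together with its inverses. In each word of `S`, the
longest prefix and the longest suffix shared with other words leave a nonempty middle. The given
significant letters are replaced by a canonical one at an end of this middle, chosen compatibly with
inversion (`IsSignificant.isMarking`). The triples `(u, a, v)` now act as prefix rewriting rules `ua
→ v` in which no left side is a prefix of another. With free cancellation they define an action of
the free group on the reduced words that have no prefix `ua`. The kernel fixes the empty word, so
these words are unique representatives (`IsMarking.eq_of_map_eq`).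

Two kinds of finiteness come from the transduction. If an accepting path is cut at the last vertex
from which several words can still be produced, the word becomes `s m v⁻¹` with `m` from a finite
list and with shared ends `s` and `v⁻¹`. The mark lies in `m`, and its place depends on regular
conditions on `s` and `v` (`isRegular_marking`). Moreover, all words produced from a vertex have the
same value in `G`, so the two sides of a rule fellow-travel with finitely many differences. A
deterministic automaton can follow them without knowing the schedule, because uniqueness of
representatives bounds how far one reader has to run ahead (`comparator_complete`). -/

/-! ### Bounded departure and asynchronous fellow travelling -/

section Departure

variable {X G : Type*} [Group G]

/-- A final segment of a word of `C` is determined by its value and the state of the word acceptor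
before it: if `c ++ y` and `c ++ z` are in `C` and have the same value, they coincide. Hence only
finitely many segments have values in a finite set. -/
theorem exists_departure_bound {μ : FreeGroup X →* G} {C : Language (X × Bool)}
    (hreg : C.IsRegular)
    (huniq : ∀ u ∈ C, ∀ v ∈ C, μ (FreeGroup.mk u) = μ (FreeGroup.mk v) → u = v)
    {E : Set G} (hE : E.Finite) :
    ∃ B : ℕ, ∀ c y : List (X × Bool), c ++ y ∈ C → μ (FreeGroup.mk y) ∈ E → y.length ≤ B := by
  obtain ⟨σ, _, D, rfl⟩ := hreg
  set Y : Set (List (X × Bool)) := {y | ∃ c, c ++ y ∈ D.accepts ∧ μ (FreeGroup.mk y) ∈ E}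
  have hY : Y.Finite := by
    choose! c hc using fun y (hy : y ∈ Y) => hy
    refine Set.Finite.of_finite_image (f := fun y => (D.eval (c y), μ (FreeGroup.mk y)))
      ((Set.finite_univ.prod hE).subset ?_) ?_
    · rintro _ ⟨y, hy, rfl⟩
      exact ⟨trivial, (hc y hy).2⟩
    · intro y hy z hz h
      simp only [Prod.mk.injEq] at h
      have h1 := (hc y hy).1
      have h2 : c y ++ z ∈ D.accepts := by
        have := (hc z hz).1
        rw [DFA.mem_accepts, DFA.eval, DFA.evalFrom_of_append] at this ⊢
        have h3 : D.evalFrom D.start (c y) = D.evalFrom D.start (c z) := h.1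
        rwa [h3]
      have := huniq _ h1 _ h2 (by rw [← FreeGroup.mul_mk, ← FreeGroup.mul_mk, map_mul, map_mul, h.2])
      exact List.append_cancel_left this
  obtain ⟨B, hB⟩ := (hY.image List.length).bddAbove
  exact ⟨B, fun c y h1 h2 => hB ⟨y, ⟨c, h1, h2⟩, rfl⟩⟩

end Departure

/-- `FellowTravel μ E g u v`: starting at a difference `g`, two readers can process `u` and `v`
letter by letter, in a suitable order, in such a way that the difference always stays in `E`. -/
inductive FellowTravel {X G : Type*} [Group G] (μ : FreeGroup X →* G) (E : Set G) :
    G → List (X × Bool) → List (X × Bool) → Prop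
  | nil {g : G} : g ∈ E → FellowTravel μ E g [] []
  | left {g : G} {a : X × Bool} {u v : List (X × Bool)} : g ∈ E →
      FellowTravel μ E ((μ (FreeGroup.mk [a]))⁻¹ * g) u v → FellowTravel μ E g (a :: u) v
  | right {g : G} {a : X × Bool} {u v : List (X × Bool)} : g ∈ E →
      FellowTravel μ E (g * μ (FreeGroup.mk [a])) u v → FellowTravel μ E g u (a :: v)

namespace FellowTravel

variable {X G : Type*} [Group G] {μ : FreeGroup X →* G} {E : Set G}

theorem mem {g : G} {u v : List (X × Bool)} (h : FellowTravel μ E g u v) : g ∈ E := by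
  cases h <;> assumption

theorem mono {E' : Set G} (hE : E ⊆ E') {g : G} {u v : List (X × Bool)}
    (h : FellowTravel μ E g u v) : FellowTravel μ E' g u v := by
  induction h with
  | nil h => exact .nil (hE h)
  | left h _ ih => exact .left (hE h) ih
  | right h _ ih => exact .right (hE h) ih

theorem right_of_nil {y v : List (X × Bool)} : ∀ {g : G},
    FellowTravel μ E g [] (y ++ v) → FellowTravel μ E (g * μ (FreeGroup.mk y)) [] v := by
  induction y with
  | nil => intro g h; simpa [← FreeGroup.one_eq_mk] using h
  | cons b y ih =>
    intro g h
    cases h with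
    | right _ h =>
      have := ih h
      rwa [mul_assoc, ← map_mul, FreeGroup.mul_mk] at this

/-- Lets the left reader move although the right one has run ahead by `y`. The given schedule must
read `a` at some time, with differences in `E` until then; as no difference beyond `y` lies in `E`,
it reads `a` with the right reader still inside `y`. -/
theorem left_step {a : X × Bool} {u v : List (X × Bool)} : ∀ {y : List (X × Bool)} {g : G},
    FellowTravel μ E g (a :: u) (y ++ v) →
    (∀ z, z ≠ [] → z <+: v → g * μ (FreeGroup.mk y) * μ (FreeGroup.mk z) ∉ E) →
    ∃ y₁ y₂, y = y₁ ++ y₂ ∧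
      FellowTravel μ E ((μ (FreeGroup.mk [a]))⁻¹ * (g * μ (FreeGroup.mk y₁))) u (y₂ ++ v) := by
  intro y
  induction y with
  | nil =>
    intro g h hz
    refine ⟨[], [], rfl, ?_⟩
    cases h with
    | left _ h => simpa [← FreeGroup.one_eq_mk] using h
    | @right _ b _ v' _ h =>
      have := hz [b] (by simp) ⟨v', by simp_all⟩
      exact absurd h.mem (by simpa [← FreeGroup.one_eq_mk] using this)
  | cons b y ih =>
    intro g h hz
    cases h with
    | left _ h => exact ⟨[], b :: y, rfl, by simpa [← FreeGroup.one_eq_mk] using h⟩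
    | right _ h =>
      have e : ∀ z : List (X × Bool), μ (FreeGroup.mk [b]) * μ (FreeGroup.mk z) =
          μ (FreeGroup.mk (b :: z)) := fun z => by
        rw [← map_mul, FreeGroup.mul_mk]; rfl
      obtain ⟨y₁, y₂, rfl, h'⟩ := ih h (fun z h1 h2 => by
        rw [mul_assoc g, e]; exact hz z h1 h2)
      refine ⟨b :: y₁, y₂, rfl, ?_⟩
      rwa [mul_assoc g, e] at h'

end FellowTravel

/-! ### A deterministic automaton that compares fellow-travelling words -/

section Comparator

variable {X G σ : Type*} [Group G]

/-- The contents of a tape that has been read up to the point where `u` is left. If `l = true`,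
then the end-of-tape symbol has been read. -/
def remainingTape {α : Type*} (l : Bool) (u : List α) : List (Option α) :=
  bif l then [] else u.map some ++ [none]

/-- With difference `g` and state `q` on the right tape, there is a word that continues the right
tape in the language and makes the difference come back to `E`. -/
def WantsRight (μ : FreeGroup X →* G) (D : DFA (X × Bool) σ) (E : Set G) (q : σ) (g : G) : Prop :=
  ∃ y : List (X × Bool), y ≠ [] ∧ D.evalFrom q y ∈ D.accept ∧ g * μ (FreeGroup.mk y) ∈ E

open Classical in
/-- The schedule of `comparator`: should it read the left tape next? -/
noncomputable def comparatorReadsLeft (μ : FreeGroup X →* G) (D : DFA (X × Bool) σ) (E : Set G)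
    (l r : Bool) (q : σ) (g : G) : Bool :=
  decide (l = false ∧ (r = true ∨ ¬ WantsRight μ D E q g))

theorem comparatorReadsLeft_iff {μ : FreeGroup X →* G} {D : DFA (X × Bool) σ} {E : Set G}
    {l r : Bool} {q : σ} {g : G} : comparatorReadsLeft μ D E l r q g = true ↔
      l = false ∧ (r = true ∨ ¬ WantsRight μ D E q g) :=
  by simp [comparatorReadsLeft]

open Classical in
/-- An automaton that keeps track of the difference of the words read on the two tapes. -/
noncomputable def comparator (μ : FreeGroup X →* G) (D : DFA (X × Bool) σ) (E K : Set G)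
    (h1 : 1 ∈ K) (x : G) : AsyncAutomaton (X × Bool) (Bool × Bool × σ × σ × K) where
  readsLeft s := comparatorReadsLeft μ D E s.1 s.2.1 s.2.2.2.1 s.2.2.2.2
  step
    | (l, r, p, q, g), o =>
      bif comparatorReadsLeft μ D E l r q g then
        match o with
        | some a => if h : (μ (FreeGroup.mk [a]))⁻¹ * g ∈ K then
            some (l, r, D.step p a, q, ⟨_, h⟩) else none
        | none => some (true, r, p, q, g)
      else bif r then none else
        match o with
        | some a => if h : g * μ (FreeGroup.mk [a]) ∈ K then
            some (l, r, p, D.step q a, ⟨_, h⟩) else none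
        | none => some (l, true, p, q, g)
  start := (false, false, D.start, D.start, ⟨1, h1⟩)
  accept := {s | s.1 = true ∧ s.2.1 = true ∧ s.2.2.1 ∈ D.accept ∧ s.2.2.2.1 ∈ D.accept ∧
    (s.2.2.2.2 : G) = x}

variable {μ : FreeGroup X →* G} {D : DFA (X × Bool) σ} {E K : Set G} {h1 : 1 ∈ K} {x : G}

/-- The schedule plays no role here: the equation for the difference holds at acceptance and is
carried back through each step. -/
theorem comparator_sound {s : Bool × Bool × σ × σ × K} {U V : List (Option (X × Bool))}
    (h : (comparator μ D E K h1 x).AcceptsFrom s U V) :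
    ∃ u v, U = remainingTape s.1 u ∧ V = remainingTape s.2.1 v ∧ (s.1 = true → u = []) ∧
      (s.2.1 = true → v = []) ∧ D.evalFrom s.2.2.1 u ∈ D.accept ∧
      D.evalFrom s.2.2.2.1 v ∈ D.accept ∧
      (s.2.2.2.2 : G) * μ (FreeGroup.mk v) = μ (FreeGroup.mk u) * x := by
  induction h with
  | @done s hs =>
    obtain ⟨l, r, p, q, g⟩ := s
    obtain ⟨rfl, rfl, hp, hq, hg⟩ : l = true ∧ r = true ∧ p ∈ D.accept ∧ q ∈ D.accept ∧
      (g : G) = x := hs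
    exact ⟨[], [], by simp [remainingTape], by simp [remainingTape], by simp, by simp,
      by simpa using hp, by simpa using hq, by simp [← FreeGroup.one_eq_mk, hg]⟩
  | @left s t o U V hl hstep _ ih =>
    obtain ⟨l, r, p, q, g⟩ := s
    obtain ⟨u, v, hU, hV, hu, hv, hp, hq, hg⟩ := ih
    have hc : comparatorReadsLeft μ D E l r q g = true := hl
    obtain ⟨rfl, -⟩ := comparatorReadsLeft_iff.1 hc
    simp only [comparator, hc, cond_true] at hstep
    cases o with
    | none =>
      simp only [Option.some.injEq] at hstep
      subst hstep
      obtain rfl : u = [] := hu rfl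
      exact ⟨[], v, by simp_all [remainingTape], hV, by simp, hv, hp, hq, hg⟩
    | some a =>
      simp only at hstep
      split_ifs at hstep with hK
      simp only [Option.some.injEq] at hstep
      subst hstep
      refine ⟨a :: u, v, by simp_all [remainingTape], hV, by simp, hv, ?_, hq, ?_⟩
      · simpa using hp
      · have e : FreeGroup.mk (a :: u) = FreeGroup.mk [a] * FreeGroup.mk u := by
          rw [FreeGroup.mul_mk]; rfl
        rw [e, map_mul, mul_assoc, ← hg]
        simp [mul_assoc]
  | @right s t o U V hl hstep _ ih =>
    obtain ⟨l, r, p, q, g⟩ := s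
    obtain ⟨u, v, hU, hV, hu, hv, hp, hq, hg⟩ := ih
    have hc : comparatorReadsLeft μ D E l r q g = false := hl
    simp only [comparator, hc, cond_false] at hstep
    obtain rfl : r = false := by cases r <;> simp_all
    simp only [cond_false] at hstep
    cases o with
    | none =>
      simp only [Option.some.injEq] at hstep
      subst hstep
      obtain rfl : v = [] := hv rfl
      exact ⟨u, [], hU, by simp_all [remainingTape], hu, by simp, hp, hq, hg⟩
    | some a =>
      simp only at hstep
      split_ifs at hstep with hK
      simp only [Option.some.injEq] at hstep
      subst hstep
      refine ⟨u, a :: v, hU, by simp_all [remainingTape], hu, by simp, hp, ?_, ?_⟩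
      · simpa using hq
      · have e : FreeGroup.mk (a :: v) = FreeGroup.mk [a] * FreeGroup.mk v := by
          rw [FreeGroup.mul_mk]; rfl
        rw [e, map_mul, ← hg]
        simp [mul_assoc]

/-- The invariant: `s` has been read on the left and `t₁ ++ y` on the right, and a fellow-travelling
schedule starts from the earlier position `(s, t₁)`. The comparator does not know this schedule, but
its lead `y` stays within the departure bound `B`, so its difference stays in `K`. -/
theorem comparator_complete {B : ℕ}
    (hB : ∀ c y : List (X × Bool), c ++ y ∈ D.accepts →
      (∃ g ∈ E, g * μ (FreeGroup.mk y) ∈ E) → y.length ≤ B)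
    (hpre : IsPrefixClosed D.accepts)
    (hK : ∀ g ∈ E, ∀ y : List (X × Bool), y.length ≤ B → g * μ (FreeGroup.mk y) ∈ K) :
    ∀ (n : ℕ) (l r : Bool) (s t₁ y u v : List (X × Bool)) (g : K),
      (remainingTape l u).length + (remainingTape r v).length = n →
      (l = true → u = []) → (r = true → v = []) →
      s ++ u ∈ D.accepts → t₁ ++ y ++ v ∈ D.accepts →
      μ (FreeGroup.mk (s ++ u)) * x = μ (FreeGroup.mk (t₁ ++ y ++ v)) → y.length ≤ B →
      FellowTravel μ E ((μ (FreeGroup.mk s))⁻¹ * μ (FreeGroup.mk t₁)) u (y ++ v) →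
      (g : G) = (μ (FreeGroup.mk s))⁻¹ * μ (FreeGroup.mk (t₁ ++ y)) →
      (comparator μ D E K h1 x).AcceptsFrom (l, r, D.eval s, D.eval (t₁ ++ y), g)
        (remainingTape l u) (remainingTape r v) := by
  intro n
  induction n using Nat.strong_induction_on with
  | _ n ih =>
  intro l r s t₁ y u v g hn hl hr hs ht hx hy hft hg
  have emul : ∀ c d : List (X × Bool), μ (FreeGroup.mk (c ++ d)) =
      μ (FreeGroup.mk c) * μ (FreeGroup.mk d) := fun c d => by
    rw [← map_mul, FreeGroup.mul_mk]
  rcases hc : comparatorReadsLeft μ D E l r (D.eval (t₁ ++ y)) g with _ | _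
  swap
  · obtain ⟨rfl, hw⟩ := comparatorReadsLeft_iff.1 hc
    cases u with
    | nil =>
      refine .left (t := (true, r, D.eval s, D.eval (t₁ ++ y), g)) hc
        (by simp only [comparator, hc, cond_true]) ?_
      exact ih _ (by rw [← hn]; simp [remainingTape]) true r s t₁ y [] v g rfl (by simp) hr hs ht hx
        hy hft hg
    | cons a u =>
      -- Prefix closure makes each prefix of `v` an admissible continuation of the right tape, so
      -- the refusal to read right excludes a return to `E` along `v`.
      have hno : ∀ z, z ≠ [] → z <+: v → (μ (FreeGroup.mk s))⁻¹ * μ (FreeGroup.mk t₁) *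
          μ (FreeGroup.mk y) * μ (FreeGroup.mk z) ∉ E := by
        intro z hz hzv hmem
        cases r with
        | true =>
          rw [hr rfl] at hzv
          exact hz (List.prefix_nil.1 hzv)
        | false =>
          refine (hw.resolve_left (by simp)) ⟨z, hz, ?_, ?_⟩
          · have : t₁ ++ y ++ z ∈ D.accepts := by
              refine hpre _ ht _ ?_
              obtain ⟨w, rfl⟩ := hzv
              exact ⟨w, by simp⟩
            rwa [DFA.mem_accepts, DFA.eval, DFA.evalFrom_of_append] at this
          · rwa [hg, emul, ← mul_assoc]
      obtain ⟨y₁, y₂, rfl, hft'⟩ := hft.left_step hno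
      have hg' : (μ (FreeGroup.mk [a]))⁻¹ * g = (μ (FreeGroup.mk (s ++ [a])))⁻¹ *
          μ (FreeGroup.mk (t₁ ++ y₁ ++ y₂)) := by
        rw [hg, emul s [a]]; simp [mul_assoc]
      have hft2 : FellowTravel μ E ((μ (FreeGroup.mk (s ++ [a])))⁻¹ *
          μ (FreeGroup.mk (t₁ ++ y₁))) u (y₂ ++ v) := by
        have : (μ (FreeGroup.mk (s ++ [a])))⁻¹ * μ (FreeGroup.mk (t₁ ++ y₁)) =
            (μ (FreeGroup.mk [a]))⁻¹ * ((μ (FreeGroup.mk s))⁻¹ * μ (FreeGroup.mk t₁) *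
              μ (FreeGroup.mk y₁)) := by
          rw [emul s [a], emul t₁]; simp only [mul_inv_rev, mul_assoc]
        rwa [this]
      have hy₂ : y₂.length ≤ B := by simp at hy; omega
      have hKK : (μ (FreeGroup.mk [a]))⁻¹ * g ∈ K := by
        rw [hg', emul (t₁ ++ y₁), ← mul_assoc]
        exact hK _ hft2.mem _ hy₂
      refine .left (t := (false, r, D.step (D.eval s) a, D.eval (t₁ ++ (y₁ ++ y₂)), ⟨_, hKK⟩)) hc
        (by simp only [comparator, hc, cond_true, hKK, dif_pos]) ?_
      have := ih _ (by rw [← hn]; simp [remainingTape]) false r (s ++ [a]) (t₁ ++ y₁) y₂ u v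
        ⟨_, hKK⟩ rfl (by simp) hr (by simpa using hs) (by simpa using ht) (by simpa using hx) hy₂ hft2
        hg'
      rw [List.append_assoc, DFA.eval_append_singleton] at this
      exact this
  · cases r with
    | true =>
      obtain rfl : l = true := by
        by_contra h
        exact Bool.false_ne_true (hc.symm.trans (comparatorReadsLeft_iff.2 ⟨by simpa using h, .inl rfl⟩))
      obtain rfl := hl rfl
      obtain rfl := hr rfl
      refine .done ⟨rfl, rfl, ?_, ?_, ?_⟩
      · simpa [DFA.mem_accepts] using hs
      · simpa [DFA.mem_accepts] using ht
      · change (g : G) = x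
        rw [hg]
        simp only [List.append_nil] at hx
        rw [← hx]; simp
    | false =>
    cases v with
    | nil =>
      refine .right (t := (l, true, D.eval s, D.eval (t₁ ++ y), g)) hc
        (by simp only [comparator, hc, cond_false]) ?_
      exact ih _ (by rw [← hn]; simp [remainingTape]) l true s t₁ y u [] g rfl hl (by simp) hs ht hx
        hy hft hg
    | cons b v =>
      -- If the left tape is finished, the schedule has only right steps left and can catch up
      -- completely. Otherwise a witness `z` of `WantsRight` makes `y ++ z` a segment between two
      -- differences in `E`, so its length is at most `B`, and `z ≠ []` leaves room for `b`.
      obtain ⟨t₂, y₂, e, hy₂, hft2⟩ : ∃ t₂ y₂, t₂ ++ y₂ = t₁ ++ y ++ [b] ∧ y₂.length ≤ B ∧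
          FellowTravel μ E ((μ (FreeGroup.mk s))⁻¹ * μ (FreeGroup.mk t₂)) u (y₂ ++ v) := by
        cases l with
        | true =>
          obtain rfl := hl rfl
          refine ⟨t₁ ++ y ++ [b], [], by simp, by simp, ?_⟩
          have := FellowTravel.right_of_nil (y := y ++ [b]) (v := v) (by simpa using hft)
          rw [mul_assoc, ← emul] at this
          simpa using this
        | false =>
          obtain ⟨z, hz, hza, hzE⟩ : WantsRight μ D E (D.eval (t₁ ++ y)) g := by
            by_contra hw
            exact Bool.false_ne_true (hc.symm.trans (comparatorReadsLeft_iff.2 ⟨rfl, .inr hw⟩))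
          refine ⟨t₁, y ++ [b], by simp, ?_, by simpa using hft⟩
          have : (y ++ z).length ≤ B := by
            refine hB t₁ _ ?_ ⟨_, hft.mem, ?_⟩
            · rw [DFA.mem_accepts, ← List.append_assoc, DFA.eval, DFA.evalFrom_of_append]
              exact hza
            · rw [hg, emul] at hzE
              rw [emul]
              simpa [mul_assoc] using hzE
          simp only [List.length_append, List.length_cons, List.length_nil] at this ⊢
          have h3 : 0 < z.length := List.length_pos_of_ne_nil hz
          omega
      have hg' : g * μ (FreeGroup.mk [b]) = (μ (FreeGroup.mk s))⁻¹ *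
          μ (FreeGroup.mk (t₂ ++ y₂)) := by
        rw [e, hg, emul _ [b], mul_assoc]
      have hKK : g * μ (FreeGroup.mk [b]) ∈ K := by
        rw [hg', emul, ← mul_assoc]
        exact hK _ hft2.mem _ hy₂
      refine .right (t := (l, false, D.eval s, D.step (D.eval (t₁ ++ y)) b, ⟨_, hKK⟩))
        hc
        (by simp only [comparator, hc, cond_false, hKK, dif_pos]) ?_
      have := ih _ (by rw [← hn]; simp [remainingTape]) l false s t₂ y₂ u v
        ⟨_, hKK⟩ rfl hl (by simp) hs (by simpa [e] using ht) (by simpa [e] using hx) hy₂ hft2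
        hg'
      rw [e, DFA.eval_append_singleton] at this
      exact this

end Comparator

theorem isAsyncAutomaticStructure_of_fellowTravel {X : Type*} [Finite X] {G : Type} [Group G]
    {μ : FreeGroup X →* G} {C : Language (X × Bool)} (hreg : C.IsRegular)
    (hpre : IsPrefixClosed C) (honto : ∀ g : G, ∃ w ∈ C, μ (FreeGroup.mk w) = g)
    (huniq : ∀ u ∈ C, ∀ v ∈ C, μ (FreeGroup.mk u) = μ (FreeGroup.mk v) → u = v)
    {E : Set G} (hE : E.Finite)
    (hft : ∀ x : Option (X × Bool), ∀ u ∈ C, ∀ v ∈ C,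
      μ (FreeGroup.mk (u ++ x.toList)) = μ (FreeGroup.mk v) → FellowTravel μ E 1 u v) :
    IsAsyncAutomaticStructure μ C := by
  refine ⟨hreg, honto, fun x => ?_⟩
  -- A segment that leads from a difference `g` to a difference `h` has the value `g⁻¹ * h`.
  obtain ⟨B, hB⟩ := exists_departure_bound hreg huniq (Set.Finite.image2 (fun g h : G => g⁻¹ * h) hE hE)
  obtain ⟨σ, _, D, rfl⟩ := hreg
  set K : Set G := insert 1 (Set.image2 (fun g y => g * μ (FreeGroup.mk y)) E
    {y : List (X × Bool) | y.length ≤ B})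
  have hK : K.Finite := (hE.image2 _ (List.finite_length_le _ B)).insert 1
  have := hK.to_subtype
  refine ⟨_, inferInstance, comparator μ D E K (Set.mem_insert _ _)
    (μ (FreeGroup.mk x.toList)), fun u v => ⟨fun h => ?_, fun ⟨hu, hv, huv⟩ => ?_⟩⟩
  · obtain ⟨u', v', hU, hV, -, -, hp, hq, hg⟩ := comparator_sound h
    have inj : ∀ {u u' : List (X × Bool)}, u.map some ++ [none] = remainingTape false u' → u = u' := by
      intro u u' h
      exact List.map_injective_iff.2 (Option.some_injective _) (List.append_cancel_right h)
    obtain rfl := inj hU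
    obtain rfl := inj hV
    refine ⟨hp, hq, ?_⟩
    have hg' : 1 * μ (FreeGroup.mk v) = μ (FreeGroup.mk u) * μ (FreeGroup.mk x.toList) := hg
    rw [← FreeGroup.mul_mk, map_mul, ← hg', one_mul]
  · have := comparator_complete (μ := μ) (D := D) (E := E) (K := K) (x := μ (FreeGroup.mk x.toList))
      (h1 := Set.mem_insert _ _) (B := B)
      (fun c y hc ⟨g, hg, hgy⟩ => hB c y hc ⟨g, hg, _, hgy, by simp⟩) hpre
      (fun g hg y hy => Or.inr ⟨g, hg, y, hy, rfl⟩) _ false false [] [] [] u v ⟨1, Set.mem_insert _ _⟩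
      rfl (by simp) (by simp) hu hv
      (by simp [← huv, ← FreeGroup.mul_mk]) (by simp)
      (by simpa [← FreeGroup.one_eq_mk] using hft x u hu v hv huv) (by simp [← FreeGroup.one_eq_mk])
    exact this

/-! ### Words and formal inverses -/

section Words

variable {X : Type*}

/-- The formal inverse of a letter. -/
def invLetter (a : X × Bool) : X × Bool := (a.1, !a.2)

@[simp]
theorem invLetter_invLetter (a : X × Bool) : invLetter (invLetter a) = a := by
  simp [invLetter]

theorem invRev_eq (w : List (X × Bool)) : FreeGroup.invRev w = (w.map invLetter).reverse := rfl

theorem invRev_cons' (a : X × Bool) (w : List (X × Bool)) :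
    FreeGroup.invRev (a :: w) = FreeGroup.invRev w ++ [invLetter a] := by
  simp [invRev_eq]

theorem invRev_concat (a : X × Bool) (w : List (X × Bool)) :
    FreeGroup.invRev (w ++ [a]) = invLetter a :: FreeGroup.invRev w := by
  simp [invRev_eq]

theorem mk_cons (a : X × Bool) (w : List (X × Bool)) :
    FreeGroup.mk (a :: w) = FreeGroup.mk [a] * FreeGroup.mk w := by
  rw [FreeGroup.mul_mk]; rfl

theorem mk_invLetter (a : X × Bool) : FreeGroup.mk [invLetter a] = (FreeGroup.mk [a])⁻¹ := by
  rw [FreeGroup.inv_mk]; rfl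

theorem isReduced_append {u v : List (X × Bool)} (hu : FreeGroup.IsReduced u)
    (hv : FreeGroup.IsReduced v)
    (h : ∀ u' a v', u = u' ++ [a] → v = invLetter a :: v' → False) :
    FreeGroup.IsReduced (u ++ v) := by
  refine List.isChain_append.2 ⟨hu, hv, fun x hx y hy hxy => ?_⟩
  obtain ⟨u', rfl⟩ := List.getLast?_eq_some_iff.1 hx
  obtain ⟨v', rfl⟩ := List.head?_eq_some_iff.1 hy
  by_contra hne
  refine h u' x v' rfl ?_
  rw [show y = invLetter x from Prod.ext hxy.symm (by
    simp only [invLetter]; rcases x with ⟨_, _ | _⟩ <;> rcases y with ⟨_, _ | _⟩ <;> simp_all)]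

theorem not_isReduced (u v : List (X × Bool)) (a : X × Bool) :
    ¬ FreeGroup.IsReduced (u ++ a :: invLetter a :: v) := fun h =>
  h.not_step (FreeGroup.Red.Step.not (L₁ := u) (L₂ := v) (x := a.1) (b := a.2))

theorem isReduced_invRev {u : List (X × Bool)} (hu : FreeGroup.IsReduced u) :
    FreeGroup.IsReduced (FreeGroup.invRev u) := by
  classical
  rw [FreeGroup.isReduced_iff_reduce_eq, FreeGroup.reduce_invRev, hu.reduce_eq]

/-- Such a word would represent an element whose square is trivial, and free groups are
torsion-free. -/
theorem invRev_ne_self {w : List (X × Bool)} (hw : FreeGroup.IsReduced w) (hne : w ≠ []) :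
    FreeGroup.invRev w ≠ w := by
  classical
  intro h
  have h1 : (FreeGroup.mk w) ^ 2 = 1 ^ 2 := by
    have : (FreeGroup.mk w)⁻¹ = FreeGroup.mk w := by rw [FreeGroup.inv_mk, h]
    rw [sq, one_pow, mul_eq_one_iff_eq_inv, this]
  have h2 : FreeGroup.mk w = 1 := pow_left_injective two_ne_zero h1
  have h3 := congrArg FreeGroup.toWord h2
  rw [FreeGroup.toWord_mk, hw.reduce_eq, FreeGroup.toWord_one] at h3
  exact hne h3

theorem eq_of_mk_eq {u v : List (X × Bool)} (hu : FreeGroup.IsReduced u)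
    (hv : FreeGroup.IsReduced v) (h : FreeGroup.mk u = FreeGroup.mk v) : u = v := by
  classical
  rw [← hu.reduce_eq, ← hv.reduce_eq]
  exact FreeGroup.reduce.sound h

end Words

/-! ### Prefix rewriting with a symmetric set of rules -/

/-- A set of triples `(u, a, v)` such that the words `u a v⁻¹` are freely reduced, closed under
formal inversion, and such that no word `u a` is a prefix of another one. -/
structure IsMarking {X : Type*} (T : List (X × Bool) → X × Bool → List (X × Bool) → Prop) :
    Prop where
  symm : ∀ u a v, T u a v → T v (invLetter a) u
  prefixFree : ∀ u a v u' a' v', T u a v → T u' a' v' → u ++ [a] <+: u' ++ [a'] →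
    u = u' ∧ a = a' ∧ v = v'
  reduced : ∀ u a v, T u a v → FreeGroup.IsReduced (u ++ a :: FreeGroup.invRev v)

/-- The freely reduced words without a prefix `u a`, where `(u, a, v) ∈ T`. -/
def avoiding {X : Type*} (T : List (X × Bool) → X × Bool → List (X × Bool) → Prop) :
    Language (X × Bool) :=
  {c | FreeGroup.IsReduced c ∧ ∀ u a v, T u a v → ¬ u ++ [a] <+: c}

namespace IsMarking

variable {X : Type*} {T : List (X × Bool) → X × Bool → List (X × Bool) → Prop}

theorem isPrefixClosed_avoiding : IsPrefixClosed (avoiding T) := by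
  intro w hw u hu
  exact ⟨hw.1.infix hu.isInfix, fun p a v hT hp => hw.2 p a v hT (hp.trans hu)⟩

theorem nil_mem_avoiding : [] ∈ avoiding T :=
  ⟨.nil, fun u a v _ h => by simpa using List.prefix_nil.1 h⟩

open Classical in
variable (T) in
/-- The right action of a letter on `avoiding T`. -/
noncomputable def step (c : List (X × Bool)) (a : X × Bool) : List (X × Bool) :=
  if h : ∃ c', c = c' ++ [invLetter a] then h.choose
  else if h : ∃ v, T c a v then h.choose else c ++ [a]

theorem step_cancel (c : List (X × Bool)) (a : X × Bool) : step T (c ++ [invLetter a]) a = c := by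
  have h : ∃ c', c ++ [invLetter a] = c' ++ [invLetter a] := ⟨c, rfl⟩
  rw [step, dif_pos h]
  exact (List.append_cancel_right h.choose_spec).symm

theorem step_append {c : List (X × Bool)} {a : X × Bool} (h : c ++ [a] ∈ avoiding T) :
    step T c a = c ++ [a] := by
  rw [step, dif_neg, dif_neg]
  · rintro ⟨v, hv⟩
    exact h.2 _ _ _ hv List.prefix_rfl
  · rintro ⟨c', rfl⟩
    have := not_isReduced c' [] (invLetter a)
    exact this (by simpa using h.1)

theorem step_of_mem (hT : IsMarking T) {c v : List (X × Bool)} {a : X × Bool} (h : T c a v) :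
    step T c a = v := by
  have h2 : ∃ v, T c a v := ⟨v, h⟩
  rw [step, dif_neg, dif_pos h2]
  · exact (hT.prefixFree _ _ _ _ _ _ h2.choose_spec h List.prefix_rfl).2.2
  · rintro ⟨c', rfl⟩
    have := not_isReduced c' (FreeGroup.invRev v) (invLetter a)
    exact this (by simpa using hT.reduced _ _ _ h)

/-- A marked prefix inside `v` would be a proper prefix of `v ++ [invLetter a]`, which is the marked
prefix of the inverse word. -/
theorem right_mem_avoiding (hT : IsMarking T) {u v : List (X × Bool)} {a : X × Bool}
    (h : T u a v) : v ∈ avoiding T := by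
  constructor
  · have := isReduced_invRev ((hT.reduced _ _ _ h).infix (L₁ := FreeGroup.invRev v)
      ⟨u ++ [a], [], by simp⟩)
    simpa using this
  · intro u' a' v' h' hp
    obtain ⟨rfl, -, -⟩ := hT.prefixFree _ _ _ _ _ _ h' (hT.symm _ _ _ h)
      (hp.trans (List.prefix_append _ _))
    have := hp.length_le
    simp at this

theorem step_cases (hT : IsMarking T) {c : List (X × Bool)} (hc : c ∈ avoiding T) (a : X × Bool) :
    (step T c a ∈ avoiding T) ∧
    (c = step T c a ++ [invLetter a] ∨ T c a (step T c a) ∨ step T c a = c ++ [a]) := by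
  by_cases h : ∃ c', c = c' ++ [invLetter a]
  · obtain ⟨c', rfl⟩ := h
    rw [step_cancel]
    exact ⟨isPrefixClosed_avoiding _ hc _ (List.prefix_append _ _), .inl rfl⟩
  by_cases h2 : ∃ v, T c a v
  · obtain ⟨v, h2⟩ := h2
    rw [hT.step_of_mem h2]
    exact ⟨hT.right_mem_avoiding h2, .inr (.inl h2)⟩
  have h3 : c ++ [a] ∈ avoiding T := by
    constructor
    · refine isReduced_append hc.1 .singleton fun u' b v' h4 h5 => h ⟨u', ?_⟩
      rw [List.cons_eq_cons] at h5
      rw [h4, h5.1, invLetter_invLetter]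
    · intro u' a' v' h' hp
      rcases List.prefix_concat_iff.1 hp with h4 | h4
      · obtain ⟨rfl, h5⟩ := List.append_inj' h4 rfl
        obtain rfl : a' = a := by simpa using h5
        exact h2 ⟨_, h'⟩
      · exact hc.2 _ _ _ h' h4
  rw [step_append h3]
  exact ⟨h3, .inr (.inr rfl)⟩

/-- Inversion exchanges cancelling with appending, and `symm` turns each rule around. This is what
makes `step` an action of the free group on `avoiding T`. -/
theorem step_step (hT : IsMarking T) {c : List (X × Bool)} (hc : c ∈ avoiding T) (a : X × Bool) :
    step T (step T c a) (invLetter a) = c := by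
  obtain ⟨-, h | h | h⟩ := hT.step_cases hc a
  · rw [step_append (by rwa [← h]), ← h]
  · exact hT.step_of_mem (hT.symm _ _ _ h)
  · rw [h]
    simpa using step_cancel (T := T) c (invLetter a)

theorem foldl_mem (hT : IsMarking T) (w : List (X × Bool)) :
    ∀ {c : List (X × Bool)}, c ∈ avoiding T → w.foldl (step T) c ∈ avoiding T := by
  induction w with
  | nil => exact fun h => h
  | cons a w ih => exact fun h => ih (hT.step_cases h a).1

theorem foldl_append_of_mem {w : List (X × Bool)} : ∀ {c : List (X × Bool)},
    c ++ w ∈ avoiding T → w.foldl (step T) c = c ++ w := by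
  induction w with
  | nil => simp
  | cons a w ih =>
    intro c h
    rw [List.foldl_cons, step_append (isPrefixClosed_avoiding _ h _ ⟨w, by simp⟩), ih (by simpa using h)]
    simp

theorem foldl_eq_of_red (hT : IsMarking T) {w w' : List (X × Bool)} (h : FreeGroup.Red w w')
    {c : List (X × Bool)} (hc : c ∈ avoiding T) : w.foldl (step T) c = w'.foldl (step T) c := by
  induction h with
  | refl => rfl
  | tail _ h ih =>
    rw [ih]
    obtain @⟨L₁, L₂, x, b⟩ := h
    simp only [List.foldl_append, List.foldl_cons]
    congr 1
    exact hT.step_step (hT.foldl_mem L₁ hc) (x, b)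

theorem foldl_eq_of_mk_eq (hT : IsMarking T) {w w' : List (X × Bool)}
    (h : FreeGroup.mk w = FreeGroup.mk w') {c : List (X × Bool)} (hc : c ∈ avoiding T) :
    w.foldl (step T) c = w'.foldl (step T) c := by
  obtain ⟨z, h1, h2⟩ := FreeGroup.Red.exact.1 h
  rw [hT.foldl_eq_of_red h1 hc, hT.foldl_eq_of_red h2 hc]

/-- A generator `u a v⁻¹` carries the empty word to `u`, then to `v`, then back to the empty word;
the words that fix it form a subgroup. -/
theorem foldl_of_mem_closure (hT : IsMarking T) {g : FreeGroup X}
    (hg : g ∈ Subgroup.closure {g | ∃ u a v, T u a v ∧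
      FreeGroup.mk (u ++ a :: FreeGroup.invRev v) = g}) :
    ∀ w, FreeGroup.mk w = g → w.foldl (step T) [] = [] := by
  have hnil : [] ∈ avoiding T := nil_mem_avoiding
  induction hg using Subgroup.closure_induction with
  | mem g hg =>
    obtain ⟨u, a, v, h, rfl⟩ := hg
    intro w hw
    have hu : u ∈ avoiding T := by
      have := hT.right_mem_avoiding (hT.symm _ _ _ h)
      exact this
    have hv := hT.right_mem_avoiding h
    rw [hT.foldl_eq_of_mk_eq hw hnil, List.foldl_append, List.foldl_cons,
      foldl_append_of_mem (w := u) (c := []) (by simpa using hu), List.nil_append, hT.step_of_mem h]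
    -- Here `v` is regarded as the result of reading `v` from the empty word, so that the inverse of
    -- `v` read next undoes it.
    nth_rewrite 1 [show v = v.foldl (step T) [] by rw [foldl_append_of_mem (by simpa using hv)]; rfl]
    rw [← List.foldl_append, hT.foldl_eq_of_mk_eq (w' := []) _ hnil]
    · rfl
    · rw [← FreeGroup.mul_mk, ← FreeGroup.inv_mk, mul_inv_cancel, FreeGroup.one_eq_mk]
  | one =>
    intro w hw
    rw [hT.foldl_eq_of_mk_eq (w' := []) (by rw [hw, FreeGroup.one_eq_mk]) hnil]
    rfl
  | mul x y _ _ hx hy =>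
    intro w hw
    obtain ⟨wx, rfl⟩ := Quot.exists_rep x
    obtain ⟨wy, rfl⟩ := Quot.exists_rep y
    rw [hT.foldl_eq_of_mk_eq (w' := wx ++ wy) (by rw [hw, ← FreeGroup.mul_mk]; rfl) hnil,
      List.foldl_append, hx wx rfl, hy wy rfl]
  | inv x _ hx =>
    intro w hw
    obtain ⟨wx, rfl⟩ := Quot.exists_rep x
    have := hx wx rfl
    nth_rewrite 1 [← this]
    rw [← List.foldl_append, hT.foldl_eq_of_mk_eq (w' := []) _ hnil]
    · rfl
    · rw [← FreeGroup.mul_mk, hw, FreeGroup.quot_mk_eq_mk, mul_inv_cancel, FreeGroup.one_eq_mk]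

variable {G : Type*} [Group G] {μ : FreeGroup X →* G}

theorem map_eq (hμ : ∀ u a v, T u a v → μ (FreeGroup.mk (u ++ a :: FreeGroup.invRev v)) = 1)
    {u v : List (X × Bool)} {a : X × Bool} (h : T u a v) :
    μ (FreeGroup.mk v) = μ (FreeGroup.mk (u ++ [a])) := by
  have := hμ _ _ _ h
  rw [show u ++ a :: FreeGroup.invRev v = (u ++ [a]) ++ FreeGroup.invRev v by simp,
    ← FreeGroup.mul_mk, ← FreeGroup.inv_mk, map_mul, map_inv, mul_inv_eq_one] at this
  exact this.symm

theorem map_step (hT : IsMarking T)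
    (hμ : ∀ u a v, T u a v → μ (FreeGroup.mk (u ++ a :: FreeGroup.invRev v)) = 1)
    {c : List (X × Bool)} (hc : c ∈ avoiding T) (a : X × Bool) :
    μ (FreeGroup.mk (step T c a)) = μ (FreeGroup.mk (c ++ [a])) := by
  obtain ⟨-, h | h | h⟩ := hT.step_cases hc a
  · nth_rewrite 2 [h]
    rw [← FreeGroup.mul_mk, ← FreeGroup.mul_mk, mk_invLetter, inv_mul_cancel_right]
  · exact map_eq hμ h
  · rw [h]

theorem exists_mem_avoiding (hT : IsMarking T)
    (hμ : ∀ u a v, T u a v → μ (FreeGroup.mk (u ++ a :: FreeGroup.invRev v)) = 1)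
    (w : List (X × Bool)) : ∃ c ∈ avoiding T, μ (FreeGroup.mk c) = μ (FreeGroup.mk w) := by
  induction w using List.reverseRecOn with
  | nil => exact ⟨[], nil_mem_avoiding, rfl⟩
  | append_singleton w a ih =>
    obtain ⟨c, hc, h⟩ := ih
    refine ⟨_, (hT.step_cases hc a).1, ?_⟩
    rw [hT.map_step hμ hc, ← FreeGroup.mul_mk, ← FreeGroup.mul_mk, map_mul, map_mul, h]

/-- The word `c d⁻¹` fixes the empty word. Hence `c d⁻¹ d`, which acts like `c`, takes the empty
word to the same place as `d`. -/
theorem eq_of_map_eq (hT : IsMarking T)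
    (hker : μ.ker ≤ Subgroup.closure {g | ∃ u a v, T u a v ∧
      FreeGroup.mk (u ++ a :: FreeGroup.invRev v) = g})
    {c d : List (X × Bool)} (hc : c ∈ avoiding T) (hd : d ∈ avoiding T)
    (h : μ (FreeGroup.mk c) = μ (FreeGroup.mk d)) : c = d := by
  have hnil : [] ∈ avoiding T := nil_mem_avoiding
  have h1 : FreeGroup.mk (c ++ FreeGroup.invRev d) ∈ μ.ker := by
    rw [MonoidHom.mem_ker, ← FreeGroup.mul_mk, ← FreeGroup.inv_mk, map_mul, map_inv, h,
      mul_inv_cancel]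
  have h2 := hT.foldl_of_mem_closure (hker h1) _ rfl
  have h3 : ((c ++ FreeGroup.invRev d) ++ d).foldl (step T) [] = c.foldl (step T) [] :=
    hT.foldl_eq_of_mk_eq (by
      rw [← FreeGroup.mul_mk, ← FreeGroup.mul_mk, ← FreeGroup.inv_mk, inv_mul_cancel_right]) hnil
  rw [List.foldl_append, h2, foldl_append_of_mem (w := c) (by simpa using hc),
    foldl_append_of_mem (w := d) (by simpa using hd)] at h3
  exact h3.symm

theorem fellowTravel_append {E : Set G} (h1 : 1 ∈ E)
    (hE : ∀ a : X × Bool, μ (FreeGroup.mk [a]) ∈ E) (u : List (X × Bool)) :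
    FellowTravel μ E 1 u u := by
  induction u with
  | nil => exact .nil h1
  | cons a u ih =>
    refine .left h1 (.right ?_ ?_)
    · rw [mul_one, ← map_inv, ← mk_invLetter]
      exact hE _
    · simpa using ih

/-- Multiplication by a letter is one of the three moves of `step`. Cancelling and appending relate
words that differ by a last letter and can be read in lockstep; the third move is a rule, where
`hft` applies. -/
theorem isAsyncAutomaticStructure_avoiding [Finite X] {G : Type} [Group G] {μ : FreeGroup X →* G}
    (hT : IsMarking T) (hsurj : Function.Surjective μ)
    (hμ : ∀ u a v, T u a v → μ (FreeGroup.mk (u ++ a :: FreeGroup.invRev v)) = 1)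
    (hker : μ.ker ≤ Subgroup.closure {g | ∃ u a v, T u a v ∧
      FreeGroup.mk (u ++ a :: FreeGroup.invRev v) = g})
    (hreg : (avoiding T).IsRegular) {E : Set G} (hE : E.Finite)
    (hft : ∀ u a v, T u a v → FellowTravel μ E 1 u v) :
    IsAsyncAutomaticStructure μ (avoiding T) := by
  set E' : Set G := E ∪ {1} ∪ Set.range (fun a : X × Bool => μ (FreeGroup.mk [a])) with hE'
  have h1 : 1 ∈ E' := .inl (.inr rfl)
  have h2 : ∀ a : X × Bool, μ (FreeGroup.mk [a]) ∈ E' := fun a => .inr ⟨a, rfl⟩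
  have hdiagR : ∀ (u : List (X × Bool)) a, FellowTravel μ E' 1 u (u ++ [a]) := by
    intro u a
    induction u with
    | nil => exact .right h1 (.nil (by simpa using h2 a))
    | cons b u ih =>
      refine .left h1 (.right ?_ ?_)
      · rw [mul_one, ← map_inv, ← mk_invLetter]; exact h2 _
      · simpa using ih
  have hdiagL : ∀ (u : List (X × Bool)) a, FellowTravel μ E' 1 (u ++ [a]) u := by
    intro u a
    induction u with
    | nil =>
      refine .left h1 (.nil ?_)
      rw [mul_one, ← map_inv, ← mk_invLetter]; exact h2 _
    | cons b u ih =>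
      refine .left h1 (.right ?_ ?_)
      · rw [mul_one, ← map_inv, ← mk_invLetter]; exact h2 _
      · simpa using ih
  refine isAsyncAutomaticStructure_of_fellowTravel hreg isPrefixClosed_avoiding ?_
    (fun u hu v hv h => hT.eq_of_map_eq hker hu hv h)
    (E := E') ((hE.union (Set.finite_singleton 1)).union (Set.finite_range _)) ?_
  · intro g
    obtain ⟨w, rfl⟩ := hsurj g
    obtain ⟨w, rfl⟩ := Quot.exists_rep w
    exact hT.exists_mem_avoiding hμ w
  · intro x u hu v hv h
    cases x with
    | none =>
      obtain rfl := hT.eq_of_map_eq hker hu hv (by simpa using h)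
      exact fellowTravel_append h1 h2 u
    | some a =>
      have h3 : step T u a = v := hT.eq_of_map_eq hker (hT.step_cases hu a).1 hv
        ((hT.map_step hμ hu a).trans h)
      obtain ⟨-, h4⟩ := hT.step_cases hu a
      rw [h3] at h4
      rcases h4 with h4 | h4 | h4
      · rw [h4]; exact hdiagL _ _
      · exact (hft _ _ _ h4).mono fun g hg => .inl (.inl hg)
      · rw [h4]; exact hdiagR _ _

end IsMarking

/-! ### A canonical marking compatible with inversion -/

/-- A set of nonempty freely reduced words, closed under formal inversion, such that in each of its
words some letter is cancelled in no nontrivial product with another word of the set. -/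
structure IsSignificant {X : Type*} (S : Set (List (X × Bool))) : Prop where
  reduced : ∀ w ∈ S, FreeGroup.IsReduced w
  nil_notMem : [] ∉ S
  symm : ∀ w ∈ S, FreeGroup.invRev w ∈ S
  overlap : ∀ w ∈ S, ∀ w₁ ∈ S, ∀ w₂ ∈ S, w₁ ≠ w → w₂ ≠ FreeGroup.invRev w → ∀ y z,
    y <+: w → y <+: w₁ → z <+: FreeGroup.invRev w → z <+: w₂ → y.length + z.length < w.length

/-- The words that are prefixes of at least two words of `S`. -/
def branchPrefixes {α : Type*} (S : Set (List α)) : Language α :=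
  {z | ∃ w ∈ S, ∃ w' ∈ S, w ≠ w' ∧ z <+: w ∧ z <+: w'}

theorem branchPrefixes_of_prefix {α : Type*} {S : Set (List α)} {y z : List α}
    (hz : z ∈ branchPrefixes S) (h : y <+: z) : y ∈ branchPrefixes S := by
  obtain ⟨w, hw, w', hw', hne, h1, h2⟩ := hz
  exact ⟨w, hw, w', hw', hne, h.trans h1, h.trans h2⟩

theorem exists_ne_of_mem_branchPrefixes {α : Type*} {S : Set (List α)} {z : List α}
    (hz : z ∈ branchPrefixes S) (w : List α) : ∃ w' ∈ S, w' ≠ w ∧ z <+: w' := by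
  obtain ⟨w₁, h1, w₂, h2, hne, hz1, hz2⟩ := hz
  by_cases h : w₁ = w
  · exact ⟨w₂, h2, fun h' => hne (h.trans h'.symm), hz2⟩
  · exact ⟨w₁, h1, h, hz1⟩

open Classical in
/-- The length of the longest prefix of `w` that is a prefix of two words of `S`. -/
noncomputable def branchLength {α : Type*} (S : Set (List α)) (w : List α) : ℕ :=
  Nat.findGreatest (fun n => w.take n ∈ branchPrefixes S) w.length

/-- A set of words that contains exactly one of `m` and its formal inverse, for each nonempty
freely reduced word `m`. -/
def orientation (X : Type*) : Set (List (X × Bool)) :=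
  {m | WellOrderingRel m (FreeGroup.invRev m)}

theorem mem_orientation_iff {X : Type*} {m : List (X × Bool)} (hm : FreeGroup.IsReduced m)
    (hne : m ≠ []) : FreeGroup.invRev m ∈ orientation X ↔ m ∉ orientation X := by
  simp only [orientation, Set.mem_ofPred_eq, FreeGroup.invRev_invRev]
  constructor
  · exact fun h h' => asymm h h'
  · intro h
    rcases trichotomous_of WellOrderingRel m (FreeGroup.invRev m) with h' | h' | h'
    · exact absurd h' h
    · exact absurd h'.symm (invRev_ne_self hm hne)
    · exact h'

/-- The part of the word `w` that is left when the longest prefixes of `w` and of its inverse that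
are shared with other words of `S` are cancelled. -/
noncomputable def middle {X : Type*} (S : Set (List (X × Bool))) (w : List (X × Bool)) :
    List (X × Bool) :=
  (w.drop (branchLength S w)).take
    (w.length - branchLength S w - branchLength S (FreeGroup.invRev w))

open Classical in
/-- The position of the distinguished letter of `w`: the first or the last letter of `middle S w`. -/
noncomputable def markPosition {X : Type*} (S : Set (List (X × Bool))) (w : List (X × Bool)) : ℕ :=
  if middle S w ∈ orientation X then branchLength S w
  else w.length - branchLength S (FreeGroup.invRev w) - 1

/-- The marking of the words of `S` given by `markPosition`. -/
def marking {X : Type*} (S : Set (List (X × Bool))) (u : List (X × Bool)) (a : X × Bool)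
    (v : List (X × Bool)) : Prop :=
  u ++ a :: FreeGroup.invRev v ∈ S ∧ markPosition S (u ++ a :: FreeGroup.invRev v) = u.length

namespace IsSignificant

variable {X : Type*} {S : Set (List (X × Bool))}

theorem nil_mem_branchPrefixes (hS : IsSignificant S) {w : List (X × Bool)} (hw : w ∈ S) :
    [] ∈ branchPrefixes S :=
  ⟨w, hw, _, hS.symm w hw, (invRev_ne_self (hS.reduced w hw)
    (fun h => hS.nil_notMem (h ▸ hw))).symm, List.nil_prefix, List.nil_prefix⟩

theorem mem_branchPrefixes_iff (hS : IsSignificant S) {w z : List (X × Bool)} (hw : w ∈ S)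
    (hz : z <+: w) : z ∈ branchPrefixes S ↔ z.length ≤ branchLength S w := by
  classical
  have hzt : w.take z.length = z := (List.prefix_iff_eq_take.1 hz).symm
  constructor
  · intro h
    refine Nat.le_findGreatest hz.length_le ?_
    rwa [hzt]
  · intro h
    -- The empty word is a shared prefix, so `Nat.findGreatest` returns a length that is attained
    -- even when it is `0`.
    have h1 : w.take (branchLength S w) ∈ branchPrefixes S :=
      Nat.findGreatest_spec (P := fun n => w.take n ∈ branchPrefixes S) (Nat.zero_le _)
        (by simpa using hS.nil_mem_branchPrefixes hw)
    refine branchPrefixes_of_prefix h1 ?_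
    rw [← hzt]
    exact List.take_prefix_take_left h

theorem branchPrefixes_overlap (hS : IsSignificant S) {w y z : List (X × Bool)} (hw : w ∈ S)
    (hy : y ∈ branchPrefixes S) (hyw : y <+: w) (hz : z ∈ branchPrefixes S)
    (hzw : z <+: FreeGroup.invRev w) : y.length + z.length < w.length := by
  obtain ⟨w₁, h1, hn1, hy1⟩ := exists_ne_of_mem_branchPrefixes hy w
  obtain ⟨w₂, h2, hn2, hz2⟩ := exists_ne_of_mem_branchPrefixes hz (FreeGroup.invRev w)
  exact hS.overlap w hw w₁ h1 w₂ h2 hn1 hn2 y z hyw hy1 hzw hz2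

theorem branchLength_le (w : List (X × Bool)) : branchLength S w ≤ w.length := by
  classical
  exact Nat.findGreatest_le _

theorem branchLength_add_lt (hS : IsSignificant S) {w : List (X × Bool)} (hw : w ∈ S) :
    branchLength S w + branchLength S (FreeGroup.invRev w) < w.length := by
  have key : ∀ w ∈ S, w.take (branchLength S w) ∈ branchPrefixes S := fun w hw =>
    (hS.mem_branchPrefixes_iff hw (List.take_prefix _ _)).2 (by simp)
  have := hS.branchPrefixes_overlap hw (key w hw) (List.take_prefix _ _)
    (key _ (hS.symm w hw)) (List.take_prefix _ _)
  have h1 := branchLength_le (S := S) w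
  have h2 := branchLength_le (S := S) (FreeGroup.invRev w)
  simp only [List.length_take, FreeGroup.invRev_length] at *
  omega

theorem middle_invRev (w : List (X × Bool)) : branchLength S w +
    branchLength S (FreeGroup.invRev w) < w.length →
    middle S (FreeGroup.invRev w) = FreeGroup.invRev (middle S w) := by
  intro h
  set a := branchLength S w
  set b := branchLength S (FreeGroup.invRev w)
  obtain ⟨p, m, q, hw, hp, hq⟩ : ∃ p m q, w = p ++ m ++ q ∧ p.length = a ∧ q.length = b := by
    refine ⟨w.take a, (w.drop a).take (w.length - a - b), (w.drop a).drop (w.length - a - b), ?_, ?_,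
      ?_⟩
    · simp
    · simp; omega
    · simp; omega
  have e1 : middle S w = m := by
    rw [middle]
    change (w.drop a).take (w.length - a - b) = m
    rw [hw, List.append_assoc, List.drop_left' hp]
    refine List.take_left' ?_
    simp; omega
  have e2 : middle S (FreeGroup.invRev w) = FreeGroup.invRev m := by
    rw [middle, FreeGroup.invRev_invRev]
    change ((FreeGroup.invRev w).drop b).take ((FreeGroup.invRev w).length - b - a) = _
    rw [hw, FreeGroup.invRev_append, FreeGroup.invRev_append, List.drop_left' (by simp [hq])]
    refine List.take_left' ?_
    simp; omega
  rw [e1, e2]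

theorem middle_ne_nil (hS : IsSignificant S) {w : List (X × Bool)} (hw : w ∈ S) :
    middle S w ≠ [] := by
  have := hS.branchLength_add_lt hw
  rw [← List.length_pos_iff, middle]
  simp
  omega

/-- The middle of the inverse word is the inverse of the middle, and exactly one of the two is in
`orientation`. So one word is marked at the first and the other at the last letter of its middle,
which is the same letter up to inversion. -/
theorem markPosition_invRev (hS : IsSignificant S) {w : List (X × Bool)} (hw : w ∈ S) :
    markPosition S (FreeGroup.invRev w) + markPosition S w + 1 = w.length := by
  have h := hS.branchLength_add_lt hw
  have hm : FreeGroup.IsReduced (middle S w) := (hS.reduced w hw).infix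
    ((List.take_prefix _ _).isInfix.trans (List.drop_suffix _ _).isInfix)
  have := mem_orientation_iff hm (hS.middle_ne_nil hw)
  rw [markPosition, markPosition, middle_invRev w h, FreeGroup.invRev_invRev,
    FreeGroup.invRev_length]
  split_ifs with h1 h2 h2 <;> simp_all <;> omega

theorem branchLength_le_markPosition (hS : IsSignificant S) {w : List (X × Bool)} (hw : w ∈ S) :
    branchLength S w ≤ markPosition S w := by
  have h := hS.branchLength_add_lt hw
  rw [markPosition]
  split_ifs <;> omega

/-- The mark lies beyond the longest shared prefix, so `u ++ [a]` is a prefix of only one word of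
`S`. -/
theorem eq_of_marking (hS : IsSignificant S) {u v u' v' : List (X × Bool)} {a a' : X × Bool}
    (h : marking S u a v) (h' : marking S u' a' v') (hp : u ++ [a] <+: u' ++ [a']) :
    u = u' ∧ a = a' ∧ v = v' := by
  have e : u ++ a :: FreeGroup.invRev v = u' ++ a' :: FreeGroup.invRev v' := by
    by_contra hne
    have h1 : u ++ [a] <+: u ++ a :: FreeGroup.invRev v := ⟨FreeGroup.invRev v, by simp⟩
    have h2 : u ++ [a] ∈ branchPrefixes S :=
      ⟨_, h.1, _, h'.1, hne, h1, hp.trans ⟨FreeGroup.invRev v', by simp⟩⟩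
    have h3 := (hS.mem_branchPrefixes_iff h.1 h1).1 h2
    have h4 := hS.branchLength_le_markPosition h.1
    rw [h.2] at h4
    simp at h3
    omega
  have hl : u.length = u'.length := by rw [← h.2, ← h'.2, e]
  obtain ⟨rfl, h2⟩ := List.append_inj e hl
  rw [List.cons_eq_cons] at h2
  exact ⟨rfl, h2.1, FreeGroup.invRev_injective h2.2⟩

theorem isMarking (hS : IsSignificant S) : IsMarking (marking S) where
  symm u a v h := by
    have e : v ++ invLetter a :: FreeGroup.invRev u =
        FreeGroup.invRev (u ++ a :: FreeGroup.invRev v) := by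
      rw [FreeGroup.invRev_append, invRev_cons', FreeGroup.invRev_invRev]
      simp
    have := hS.markPosition_invRev h.1
    rw [h.2] at this
    refine ⟨e ▸ hS.symm _ h.1, ?_⟩
    rw [e]
    simp only [List.length_append, List.length_cons, FreeGroup.invRev_length] at this
    omega
  prefixFree _ _ _ _ _ _ h h' hp := hS.eq_of_marking h h' hp
  reduced _ _ _ h := hS.reduced _ h.1

theorem exists_marking (hS : IsSignificant S) {w : List (X × Bool)} (hw : w ∈ S) :
    ∃ u a v, marking S u a v ∧ u ++ a :: FreeGroup.invRev v = w := by
  have h := hS.markPosition_invRev hw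
  have hlt : markPosition S w < w.length := by omega
  have e : w.take (markPosition S w) ++ w[markPosition S w] ::
      FreeGroup.invRev (FreeGroup.invRev (w.drop (markPosition S w + 1))) = w := by
    rw [FreeGroup.invRev_invRev, List.getElem_cons_drop, List.take_append_drop]
  refine ⟨_, _, _, ⟨by rwa [e], ?_⟩, e⟩
  rw [e]
  simp; omega

end IsSignificant

/-! ### Regular languages by Myhill–Nerode arguments -/

section Regular

variable {α : Type*}

theorem isRegular_of_invariant {β : Type*} {L : Language α} (f : List α → β)
    (hf : (Set.range f).Finite) (h : ∀ u v, f u = f v → ∀ y, u ++ y ∈ L → v ++ y ∈ L) :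
    L.IsRegular := by
  refine Language.IsRegular.of_finite_range_leftQuotient ?_
  choose! g hg using fun b (hb : b ∈ Set.range f) => hb
  refine (hf.image fun b => L.leftQuotient (g b)).subset ?_
  rintro _ ⟨w, rfl⟩
  refine ⟨f w, ⟨w, rfl⟩, ?_⟩
  have := hg (f w) ⟨w, rfl⟩
  ext y
  exact ⟨h _ _ this y, h _ _ this.symm y⟩

theorem isRegular_iUnion {ι : Type*} [Finite ι] {L : ι → Language α}
    (h : ∀ i, (L i).IsRegular) : Language.IsRegular ({w | ∃ i, w ∈ L i} : Language α) := by
  refine isRegular_of_invariant (fun w i => (L i).leftQuotient w)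
    ((Set.Finite.pi' fun i => (h i).finite_range_leftQuotient).subset ?_) ?_
  · rintro _ ⟨w, rfl⟩ i
    exact ⟨w, rfl⟩
  · rintro u v huv y ⟨i, hi⟩
    have hi' : y ∈ (L i).leftQuotient u := hi
    rw [show (L i).leftQuotient u = (L i).leftQuotient v from congrFun huv i] at hi'
    exact ⟨i, hi'⟩

/-- A continuation longer than `m` must end in `m`, which reduces the question to `L`; the finitely
many shorter continuations are recorded in the invariant. -/
theorem isRegular_append_word [Finite α] {L : Language α} (h : L.IsRegular) (m : List α) :
    Language.IsRegular ({w | ∃ s ∈ L, w = s ++ m} : Language α) := by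
  refine isRegular_of_invariant (β := Language α × Set (List α))
    (fun w => (L.leftQuotient w, {y | y.length ≤ m.length ∧ ∃ s ∈ L, w ++ y = s ++ m}))
    ((h.finite_range_leftQuotient.prod (List.finite_length_le α m.length).powerset).subset ?_) ?_
  · rintro _ ⟨w, rfl⟩
    exact ⟨⟨w, rfl⟩, fun y hy => hy.1⟩
  · rintro u v huv y ⟨s, hs, hy⟩
    rw [Prod.mk.injEq] at huv
    by_cases hl : y.length ≤ m.length
    · have : y ∈ {y | y.length ≤ m.length ∧ ∃ s ∈ L, u ++ y = s ++ m} := ⟨hl, s, hs, hy⟩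
      rw [huv.2] at this
      exact this.2
    · have h1 : m <:+ y := List.suffix_of_suffix_length_le ⟨s, hy.symm⟩ ⟨u, rfl⟩ (by omega)
      obtain ⟨z, rfl⟩ := h1
      rw [← List.append_assoc] at hy
      obtain rfl := List.append_cancel_right hy
      have hs' : z ∈ L.leftQuotient u := hs
      rw [huv.1] at hs'
      exact ⟨v ++ z, hs', by simp⟩

theorem isRegular_preimage_append {L : Language α} (h : L.IsRegular) (m : List α) :
    Language.IsRegular ({s | s ++ m ∈ L} : Language α) := by
  refine isRegular_of_invariant _ h.finite_range_leftQuotient fun u v huv y hy => ?_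
  have : y ++ m ∈ L.leftQuotient u := by
    change u ++ (y ++ m) ∈ L
    rwa [← List.append_assoc]
  rw [huv] at this
  change v ++ y ++ m ∈ L
  rwa [List.append_assoc]

theorem isRegular_preimage_map {β : Type*} {L : Language β} (h : L.IsRegular) (f : α → β) :
    Language.IsRegular ({s | s.map f ∈ L} : Language α) := by
  refine isRegular_of_invariant (fun w => L.leftQuotient (w.map f))
    (h.finite_range_leftQuotient.subset ?_) fun u v huv y hy => ?_
  · rintro _ ⟨w, rfl⟩
    exact ⟨_, rfl⟩
  · have : y.map f ∈ L.leftQuotient (u.map f) := by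
      change u.map f ++ y.map f ∈ L
      rwa [← List.map_append]
    rw [huv] at this
    change (v ++ y).map f ∈ L
    rwa [List.map_append]

theorem isRegular_of_subset_nil {L : Language α} (h : ∀ w ∈ L, w = []) : L.IsRegular := by
  refine isRegular_of_invariant (β := Prop × Prop) (fun w => (w = [], w ∈ L)) (Set.toFinite _) ?_
  intro u v huv y hy
  rw [Prod.mk.injEq] at huv
  obtain ⟨rfl, rfl⟩ := List.append_eq_nil_iff.1 (h _ hy)
  obtain rfl : v = [] := by simpa using huv.1
  exact hy

/-- For a word that is still in `avoiding T`, the last letter decides whether a continuation cancels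
at the seam, and the left quotient of `D` decides whether it completes a marked prefix. -/
theorem isRegular_avoiding {X : Type*} [Finite X]
    {T : List (X × Bool) → X × Bool → List (X × Bool) → Prop}
    (h : Language.IsRegular ({z | ∃ u a v, T u a v ∧ z = u ++ [a]} : Language (X × Bool))) :
    (avoiding T).IsRegular := by
  set D : Language (X × Bool) := {z | ∃ u a v, T u a v ∧ z = u ++ [a]}
  have hC : ∀ c, c ∈ avoiding T ↔ FreeGroup.IsReduced c ∧ ∀ z ∈ D, ¬ z <+: c := by
    intro c
    refine ⟨fun hc => ⟨hc.1, ?_⟩, fun hc => ⟨hc.1, fun u a v hT => hc.2 _ ⟨u, a, v, hT, rfl⟩⟩⟩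
    rintro _ ⟨u, a, v, hT, rfl⟩
    exact hc.2 u a v hT
  refine isRegular_of_invariant (β := Prop × Option (X × Bool) × Language (X × Bool))
    (fun c => (c ∈ avoiding T, c.getLast?, D.leftQuotient c))
    ((Set.finite_univ.prod (Set.finite_univ.prod h.finite_range_leftQuotient)).subset ?_) ?_
  · rintro _ ⟨w, rfl⟩
    exact ⟨trivial, trivial, w, rfl⟩
  · intro u v huv y hy
    simp only [Prod.mk.injEq] at huv
    obtain ⟨h1, h2, h3⟩ := huv
    have hu : u ∈ avoiding T := IsMarking.isPrefixClosed_avoiding _ hy _ (List.prefix_append _ _)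
    have hv : v ∈ avoiding T := h1 ▸ hu
    rw [hC] at hy hv ⊢
    refine ⟨?_, fun z hz hp => ?_⟩
    · have := List.isChain_append.1 hy.1
      rw [h2] at this
      exact List.isChain_append.2 ⟨hv.1, this.2⟩
    · rcases List.prefix_or_prefix_of_prefix hp (List.prefix_append v y) with hp' | ⟨y', rfl⟩
      · exact hv.2 z hz hp'
      · have : y' ∈ D.leftQuotient v := hz
        rw [← h3] at this
        exact hy.2 _ this ((List.prefix_append_right_inj u).2 ((List.prefix_append_right_inj v).1 hp))

end Regular

/-! ### Bounded middles and regularity of the marked prefixes -/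

theorem IsSignificant.branchLength_eq_iff {X : Type*} {S : Set (List (X × Bool))}
    (hS : IsSignificant S) {s m t : List (X × Bool)} (hw : s ++ m ++ t ∈ S) {n : ℕ}
    (hn : n < m.length) : branchLength S (s ++ m ++ t) = s.length + n ↔
      s ++ m.take n ∈ branchPrefixes S ∧ s ++ m.take (n + 1) ∉ branchPrefixes S := by
  have hp : ∀ n, s ++ m.take n <+: s ++ m ++ t := fun n => by
    rw [List.append_assoc, List.prefix_append_right_inj]
    exact (List.take_prefix _ _).trans (List.prefix_append _ _)
  rw [hS.mem_branchPrefixes_iff hw (hp n), hS.mem_branchPrefixes_iff hw (hp (n + 1))]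
  simp
  omega

/-- A description of `S` as a finite union of sets `{s m v⁻¹ | (s, v) ∈ R}` for relations `R` for
which preimages of regular languages are regular, where `s` and `v` are prefixes of at least two
words of `S`. -/
structure IsBranchDecomposition {X ι : Type*} (S : Set (List (X × Bool)))
    (R : ι → List (X × Bool) → List (X × Bool) → Prop) (m : ι → List (X × Bool)) : Prop where
  exists_eq : ∀ w ∈ S, ∃ i s v, R i s v ∧ w = s ++ m i ++ FreeGroup.invRev v
  mem : ∀ i s v, R i s v → s ++ m i ++ FreeGroup.invRev v ∈ S
  left : ∀ i s v, R i s v → s ∈ branchPrefixes S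
  right : ∀ i s v, R i s v → v ∈ branchPrefixes S
  regular : ∀ i, ∀ Y : Language (X × Bool), Y.IsRegular →
    Language.IsRegular ({s | ∃ v ∈ Y, R i s v} : Language (X × Bool))

namespace IsBranchDecomposition

variable {X ι : Type*} {S : Set (List (X × Bool))}
  {R : ι → List (X × Bool) → List (X × Bool) → Prop} {m : ι → List (X × Bool)}

/-- The end `v⁻¹` is shared from the other side, so the overlap condition keeps shared prefixes away
from it. -/
theorem lt_length (h : IsBranchDecomposition S R m) (hS : IsSignificant S) {i : ι}
    {s v z : List (X × Bool)} (hR : R i s v) (hz : z ∈ branchPrefixes S)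
    (hzw : z <+: s ++ m i ++ FreeGroup.invRev v) : z.length < (s ++ m i).length := by
  have := hS.branchPrefixes_overlap (h.mem i s v hR) hz hzw (h.right i s v hR)
    (by rw [FreeGroup.invRev_append, FreeGroup.invRev_invRev]; exact List.prefix_append _ _)
  simp at this ⊢
  omega

/-- By `lt_length` a shared prefix ends inside `s ++ m i`, and no word `s ++ m i` is itself shared.
So the shared prefixes are the common prefixes of two incomparable words of the regular language
`Q`, a property that only depends on the left quotient of `Q`. -/
theorem isRegular_branchPrefixes [Finite X] [Finite ι] (h : IsBranchDecomposition S R m)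
    (hS : IsSignificant S) : (branchPrefixes S).IsRegular := by
  set Q : Language (X × Bool) := {z | ∃ i, z ∈ ({w | ∃ s ∈ ({s | ∃ v ∈ (⊤ : Language (X × Bool)),
    R i s v} : Language (X × Bool)), w = s ++ m i} : Language (X × Bool))} with hQ
  have htop : (⊤ : Language (X × Bool)).IsRegular :=
    isRegular_of_invariant (fun _ => ()) (Set.toFinite _) fun _ _ _ _ _ => trivial
  have hQreg : Q.IsRegular := isRegular_iUnion fun i => isRegular_append_word (h.regular i _ htop) _
  have key : ∀ z, z ∈ branchPrefixes S ↔ ∃ q₁ ∈ Q, ∃ q₂ ∈ Q, z <+: q₁ ∧ z <+: q₂ ∧ ¬ q₁ <+: q₂ ∧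
      ¬ q₂ <+: q₁ := by
    intro z
    constructor
    · rintro ⟨w₁, h1, w₂, h2, hne, hz1, hz2⟩
      obtain ⟨i₁, s₁, v₁, hR1, rfl⟩ := h.exists_eq w₁ h1
      obtain ⟨i₂, s₂, v₂, hR2, rfl⟩ := h.exists_eq w₂ h2
      have hl1 := h.lt_length hS hR1 ⟨_, h1, _, h2, hne, hz1, hz2⟩ hz1
      have hl2 := h.lt_length hS hR2 ⟨_, h1, _, h2, hne, hz1, hz2⟩ hz2
      refine ⟨s₁ ++ m i₁, ⟨i₁, s₁, ⟨v₁, trivial, hR1⟩, rfl⟩, s₂ ++ m i₂,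
        ⟨i₂, s₂, ⟨v₂, trivial, hR2⟩, rfl⟩,
        List.prefix_of_prefix_length_le hz1 (List.prefix_append _ _) hl1.le,
        List.prefix_of_prefix_length_le hz2 (List.prefix_append _ _) hl2.le, fun hp => ?_,
        fun hp => ?_⟩
      · have := h.lt_length hS hR1 ⟨_, h1, _, h2, hne, List.prefix_append _ _,
          hp.trans (List.prefix_append _ _)⟩ (List.prefix_append _ _)
        exact lt_irrefl _ this
      · have := h.lt_length hS hR2 ⟨_, h1, _, h2, hne, hp.trans (List.prefix_append _ _),
          List.prefix_append _ _⟩ (List.prefix_append _ _)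
        exact lt_irrefl _ this
    · rintro ⟨_, ⟨i₁, s₁, ⟨v₁, -, hR1⟩, rfl⟩, _, ⟨i₂, s₂, ⟨v₂, -, hR2⟩, rfl⟩, hz1, hz2, hn1, hn2⟩
      refine ⟨_, h.mem _ _ _ hR1, _, h.mem _ _ _ hR2, fun he => ?_,
        hz1.trans (List.prefix_append _ _), hz2.trans (List.prefix_append _ _)⟩
      rcases List.prefix_or_prefix_of_prefix (List.prefix_append (s₁ ++ m i₁) (FreeGroup.invRev v₁))
        (he.symm ▸ List.prefix_append (s₂ ++ m i₂) (FreeGroup.invRev v₂)) with h' | h'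
      · exact hn1 h'
      · exact hn2 h'
  refine isRegular_of_invariant _ hQreg.finite_range_leftQuotient fun u v huv y hy => ?_
  rw [key] at hy ⊢
  obtain ⟨_, h1, _, h2, ⟨q₁, rfl⟩, ⟨q₂, rfl⟩, hn1, hn2⟩ := hy
  have h1' : y ++ q₁ ∈ Q.leftQuotient u := by
    change u ++ (y ++ q₁) ∈ Q
    rwa [← List.append_assoc]
  have h2' : y ++ q₂ ∈ Q.leftQuotient u := by
    change u ++ (y ++ q₂) ∈ Q
    rwa [← List.append_assoc]
  rw [huv] at h1' h2'
  simp only [List.append_assoc, List.prefix_append_right_inj] at hn1 hn2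
  refine ⟨_, h1', _, h2', ?_, ?_, ?_, ?_⟩ <;>
    simp only [List.prefix_append_right_inj, List.prefix_append, hn1, hn2, not_false_eq_true]

open Classical in
/-- The position of the distinguished letter in `m`, when the parts of lengths `n₁` and `n₂` at the
two ends of `m` are shared with other words. -/
noncomputable def localMark (m : List (X × Bool)) (n₁ n₂ : ℕ) : ℕ :=
  if (m.drop n₁).take (m.length - n₁ - n₂) ∈ orientation X then n₁ else m.length - n₂ - 1

theorem exists_branchLength (h : IsBranchDecomposition S R m) (hS : IsSignificant S) {i : ι}
    {s v : List (X × Bool)} (hR : R i s v) :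
    ∃ n₁ n₂, n₁ + n₂ < (m i).length ∧
      branchLength S (s ++ m i ++ FreeGroup.invRev v) = s.length + n₁ ∧
      branchLength S (FreeGroup.invRev (s ++ m i ++ FreeGroup.invRev v)) = v.length + n₂ := by
  have hw := h.mem i s v hR
  have h1 := hS.branchLength_add_lt hw
  have h2 := (hS.mem_branchPrefixes_iff hw (z := s)
    (by rw [List.append_assoc]; exact List.prefix_append _ _)).1 (h.left i s v hR)
  have h3 := (hS.mem_branchPrefixes_iff (hS.symm _ hw) (z := v)
    (by rw [FreeGroup.invRev_append, FreeGroup.invRev_invRev]; exact List.prefix_append _ _)).1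
    (h.right i s v hR)
  refine ⟨branchLength S (s ++ m i ++ FreeGroup.invRev v) - s.length,
    branchLength S (FreeGroup.invRev (s ++ m i ++ FreeGroup.invRev v)) - v.length, ?_, ?_, ?_⟩
  · simp only [List.length_append, FreeGroup.invRev_length] at h1
    omega
  · omega
  · omega

/-- The mark is local: its place in `m i` depends only on how far the shared parts reach into `m i`
from both ends. -/
theorem markPosition_eq {i : ι} {s v : List (X × Bool)} {n₁ n₂ : ℕ}
    (hn : n₁ + n₂ < (m i).length)
    (h1 : branchLength S (s ++ m i ++ FreeGroup.invRev v) = s.length + n₁)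
    (h2 : branchLength S (FreeGroup.invRev (s ++ m i ++ FreeGroup.invRev v)) = v.length + n₂) :
    markPosition S (s ++ m i ++ FreeGroup.invRev v) = s.length + localMark (m i) n₁ n₂ := by
  have hm : middle S (s ++ m i ++ FreeGroup.invRev v) =
      ((m i).drop n₁).take ((m i).length - n₁ - n₂) := by
    rw [middle, h1, h2, List.append_assoc, List.drop_length_add_append,
      List.drop_append_of_le_length (by omega), List.take_append_of_le_length]
    · congr 1
      simp
      omega
    · simp
      omega
  rw [markPosition, hm, localMark, h1, h2]
  split_ifs
  · rfl
  · simp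
    omega

theorem localMark_lt {m : List (X × Bool)} {n₁ n₂ : ℕ} (hn : n₁ + n₂ < m.length) :
    localMark m n₁ n₂ < m.length := by
  rw [localMark]
  split_ifs <;> omega

/-- For fixed `i`, `n₁`, `n₂`, the lengths of the shared parts amount to one regular condition on
`s` and one on `v`, and the field `regular` transfers the latter to `s`. The marked prefix is then
`s` followed by a fixed word. -/
theorem isRegular_marking [Finite X] [Finite ι] (h : IsBranchDecomposition S R m)
    (hS : IsSignificant S) : Language.IsRegular
      ({z | ∃ u a v, marking S u a v ∧ z = u ++ [a]} : Language (X × Bool)) := by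
  have hP := h.isRegular_branchPrefixes hS
  set P := branchPrefixes S with hPdef
  set Y : ι → ℕ → Language (X × Bool) := fun i n =>
    ({v | v ++ (FreeGroup.invRev (m i)).take n ∈ P} : Language (X × Bool)) ⊓
    ({v | v ++ (FreeGroup.invRev (m i)).take (n + 1) ∈ P} : Language (X × Bool))ᶜ with hY
  have hYreg : ∀ i n, (Y i n).IsRegular := fun i n =>
    (isRegular_preimage_append hP _).inf (isRegular_preimage_append hP _).compl
  set Z : (i : ι) → ℕ → ℕ → Language (X × Bool) := fun i n₁ n₂ =>
    ({s | s ++ (m i).take n₁ ∈ P} : Language (X × Bool)) ⊓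
    ({s | s ++ (m i).take (n₁ + 1) ∈ P} : Language (X × Bool))ᶜ ⊓
    ({s | ∃ v ∈ Y i n₂, R i s v} : Language (X × Bool)) with hZ
  have hZreg : ∀ i n₁ n₂, (Z i n₁ n₂).IsRegular := fun i n₁ n₂ =>
    ((isRegular_preimage_append hP _).inf (isRegular_preimage_append hP _).compl).inf
      (h.regular i _ (hYreg i n₂))
  have hreg := isRegular_iUnion
    (ι := (i : ι) × {n : Fin (m i).length × Fin (m i).length // (n.1 : ℕ) + n.2 < (m i).length})
    (fun j => isRegular_append_word (hZreg j.1 j.2.1.1 j.2.1.2)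
      ((m j.1).take (localMark (m j.1) j.2.1.1 j.2.1.2 + 1)))
  have hdata : ∀ i s v n₁ n₂, R i s v → n₁ + n₂ < (m i).length →
      ((s ++ (m i).take n₁ ∈ P ∧ s ++ (m i).take (n₁ + 1) ∉ P) ∧ v ∈ Y i n₂ ↔
      branchLength S (s ++ m i ++ FreeGroup.invRev v) = s.length + n₁ ∧
      branchLength S (FreeGroup.invRev (s ++ m i ++ FreeGroup.invRev v)) = v.length + n₂) := by
    intro i s v n₁ n₂ hR hn
    have hw := h.mem i s v hR
    have e : FreeGroup.invRev (s ++ m i ++ FreeGroup.invRev v) =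
        v ++ FreeGroup.invRev (m i) ++ FreeGroup.invRev s := by
      simp [FreeGroup.invRev_append]
    rw [hS.branchLength_eq_iff hw (by omega), e, hS.branchLength_eq_iff (e ▸ hS.symm _ hw)
      (by rw [FreeGroup.invRev_length]; omega)]
    rfl
  have htake : ∀ i s v u a v' n₁ n₂, R i s v → n₁ + n₂ < (m i).length →
      branchLength S (s ++ m i ++ FreeGroup.invRev v) = s.length + n₁ →
      branchLength S (FreeGroup.invRev (s ++ m i ++ FreeGroup.invRev v)) = v.length + n₂ →
      s ++ m i ++ FreeGroup.invRev v = u ++ a :: FreeGroup.invRev v' →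
      markPosition S (u ++ a :: FreeGroup.invRev v') = u.length →
      u ++ [a] = s ++ (m i).take (localMark (m i) n₁ n₂ + 1) := by
    intro i s v u a v' n₁ n₂ hR hn h1 h2 he hu
    have h3 := markPosition_eq hn h1 h2
    rw [he, hu] at h3
    have h4 := localMark_lt hn
    have h5 : u ++ [a] = (u ++ a :: FreeGroup.invRev v').take (u.length + 1) := by
      simp [List.take_append]
    rw [h5, ← he, h3, add_assoc, List.append_assoc, List.take_length_add_append,
      List.take_append_of_le_length (by omega)]
  refine (congrArg Language.IsRegular ?_).mpr hreg
  ext z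
  constructor
  · rintro ⟨u, a, v', ⟨hmem, hpos⟩, rfl⟩
    obtain ⟨i, s, v, hR, he⟩ := h.exists_eq _ hmem
    obtain ⟨n₁, n₂, hn, h1, h2⟩ := h.exists_branchLength hS hR
    obtain ⟨hs, hv⟩ := (hdata i s v n₁ n₂ hR hn).2 ⟨h1, h2⟩
    exact ⟨⟨i, ⟨⟨n₁, by omega⟩, ⟨n₂, by omega⟩⟩, hn⟩, s, ⟨hs, v, hv, hR⟩,
      htake i s v u a v' n₁ n₂ hR hn h1 h2 he.symm hpos⟩
  · rintro ⟨⟨i, ⟨⟨n₁, _⟩, ⟨n₂, _⟩⟩, hn⟩, s, ⟨hs, v, hv, hR⟩, rfl⟩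
    obtain ⟨h1, h2⟩ := (hdata i s v n₁ n₂ hR hn).1 ⟨hs, hv⟩
    obtain ⟨u, a, v', hm, he⟩ := hS.exists_marking (h.mem i s v hR)
    exact ⟨u, a, v', hm, (htake i s v u a v' n₁ n₂ hR hn h1 h2 he.symm hm.2).symm⟩

theorem exists_of_marking (h : IsBranchDecomposition S R m) (hS : IsSignificant S)
    {u v' : List (X × Bool)} {a : X × Bool} (hm : marking S u a v') :
    ∃ i s v p q, R i s v ∧ m i = p ++ a :: FreeGroup.invRev q ∧ u = s ++ p ∧ v' = v ++ q := by
  obtain ⟨i, s, v, hR, he⟩ := h.exists_eq _ hm.1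
  obtain ⟨n₁, n₂, hn, h1, h2⟩ := h.exists_branchLength hS hR
  have h3 := markPosition_eq hn h1 h2
  rw [← he, hm.2] at h3
  have h4 := localMark_lt hn
  have h5 : u = s ++ (m i).take (localMark (m i) n₁ n₂) := by
    have : u = (u ++ a :: FreeGroup.invRev v').take u.length := by simp
    rw [this, he, h3, List.append_assoc, List.take_length_add_append,
      List.take_append_of_le_length h4.le]
  have h6 : a :: FreeGroup.invRev v' =
      (m i).drop (localMark (m i) n₁ n₂) ++ FreeGroup.invRev v := by
    have : a :: FreeGroup.invRev v' = (u ++ a :: FreeGroup.invRev v').drop u.length := by simp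
    rw [this, he, h3, List.append_assoc, List.drop_length_add_append,
      List.drop_append_of_le_length h4.le]
  rw [List.drop_eq_getElem_cons h4, List.cons_append, List.cons_eq_cons] at h6
  refine ⟨i, s, v, (m i).take (localMark (m i) n₁ n₂),
    FreeGroup.invRev ((m i).drop (localMark (m i) n₁ n₂ + 1)), hR, ?_, h5, ?_⟩
  · rw [FreeGroup.invRev_invRev, h6.1, List.getElem_cons_drop, List.take_append_drop]
  · rw [← FreeGroup.invRev_invRev (L₁ := v'), h6.2, FreeGroup.invRev_append,
      FreeGroup.invRev_invRev]

end IsBranchDecomposition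

/-! ### Fellow travelling of the two sides of a rule -/

theorem FellowTravel.of_prefixes {X G : Type*} [Group G] {μ : FreeGroup X →* G} {E : Set G} :
    ∀ {u v : List (X × Bool)} {g : G}, (∀ u₁ v₁, u₁ <+: u → v₁ <+: v →
      (μ (FreeGroup.mk u₁))⁻¹ * g * μ (FreeGroup.mk v₁) ∈ E) → FellowTravel μ E g u v
  | [], [], g, h => .nil (by
      simpa [← FreeGroup.one_eq_mk] using h [] [] List.prefix_rfl List.prefix_rfl)
  | [], b :: v, g, h => by
      refine .right (by
        simpa [← FreeGroup.one_eq_mk] using h [] [] List.nil_prefix List.nil_prefix)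
        (of_prefixes fun u₁ v₁ hu hv => ?_)
      have := h u₁ (b :: v₁) hu (List.cons_prefix_cons.2 ⟨rfl, hv⟩)
      rw [mk_cons, map_mul] at this
      simpa [mul_assoc] using this
  | a :: u, v, g, h => by
      refine .left (by
        simpa [← FreeGroup.one_eq_mk] using h [] [] List.nil_prefix List.nil_prefix)
        (of_prefixes fun u₁ v₁ hu hv => ?_)
      have := h (a :: u₁) v₁ (List.cons_prefix_cons.2 ⟨rfl, hu⟩) hv
      rw [mk_cons, map_mul] at this
      simpa [mul_assoc] using this

theorem FellowTravel.append {X G : Type*} [Group G] {μ : FreeGroup X →* G} {E E' : Set G}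
    {s t u v : List (X × Bool)} {g : G} (h : FellowTravel μ E g s t)
    (hE : ∀ g ∈ E, ∀ u₁ v₁, u₁ <+: u → v₁ <+: v →
      (μ (FreeGroup.mk u₁))⁻¹ * g * μ (FreeGroup.mk v₁) ∈ E') :
    FellowTravel μ E' g (s ++ u) (t ++ v) := by
  have hsub : ∀ g ∈ E, g ∈ E' := fun g hg => by
    simpa [← FreeGroup.one_eq_mk] using hE g hg [] [] List.nil_prefix List.nil_prefix
  induction h with
  | nil h => exact .of_prefixes (hE _ h)
  | left h _ ih => exact .left (hsub _ h) ih
  | right h _ ih => exact .right (hsub _ h) ih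

theorem IsBranchDecomposition.exists_fellowTravel {X ι G : Type*} [Finite X] [Finite ι] [Group G]
    {μ : FreeGroup X →* G} {S : Set (List (X × Bool))}
    {R : ι → List (X × Bool) → List (X × Bool) → Prop} {m : ι → List (X × Bool)}
    (h : IsBranchDecomposition S R m) (hS : IsSignificant S) {E : Set G} (hE : E.Finite)
    (hR : ∀ i s v, R i s v → FellowTravel μ E 1 s v) :
    ∃ E' : Set G, E'.Finite ∧ ∀ u a v, marking S u a v → FellowTravel μ E' 1 u v := by
  obtain ⟨B, hB⟩ := (Set.finite_range fun i => (m i).length).bddAbove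
  have hW := (List.finite_length_le (X × Bool) B).image fun w => μ (FreeGroup.mk w)
  -- The mark splits `m i` into `p`, `a` and `q⁻¹`. Beyond `s` and `v`, differences change only by
  -- prefixes of `p` and `q`, whose lengths are at most `B`.
  refine ⟨_, Set.Finite.image2 (fun a b : G => a * b)
    (Set.Finite.image2 (fun a b : G => a⁻¹ * b) hW hE) hW, fun u a v' hm => ?_⟩
  obtain ⟨i, s, v, p, q, hi, hpq, rfl, rfl⟩ := h.exists_of_marking hS hm
  have hlen : p.length + q.length < B + 1 := by
    have : (m i).length ≤ B := hB ⟨i, rfl⟩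
    rw [hpq] at this
    simp at this
    omega
  refine (hR i s v hi).append fun g hg u₁ v₁ hu hv => ?_
  have h1 := hu.length_le
  have h2 := hv.length_le
  exact ⟨_, ⟨_, ⟨u₁, by change u₁.length ≤ B; omega, rfl⟩, g, hg, rfl⟩, _,
    ⟨v₁, by change v₁.length ≤ B; omega, rfl⟩, rfl⟩

/-! ### Paths and the words produced from a vertex -/

namespace TransductionAutomaton

variable {α σ : Type*} {M : TransductionAutomaton α σ}

theorem Path.trans {p q r : σ} {u t u' t' : List α} (h : M.Path p q u t) (h' : M.Path q r u' t') :
    M.Path p r (u ++ u') (t ++ t') := by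
  induction h with
  | nil => simpa using h'
  | cons he _ ih => simpa using Path.cons he (ih h')

theorem Path.exists_split {p q : σ} {w t : List α} (h : M.Path p q w t) :
    ∀ {s s' : List α}, w = s ++ s' →
      ∃ r t₁ t₂, t = t₁ ++ t₂ ∧ M.Path p r s t₁ ∧ M.Path r q s' t₂ := by
  induction h with
  | nil p =>
    intro s s' hs
    obtain ⟨rfl, rfl⟩ := List.append_eq_nil_iff.1 hs.symm
    exact ⟨p, [], [], rfl, .nil p, .nil p⟩
  | @cons p q r a b u v he hp ih =>
    intro s s' hs
    cases s with
    | nil =>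
      obtain rfl : _ = s' := hs
      exact ⟨p, [], _, rfl, .nil p, .cons he hp⟩
    | cons x s =>
      obtain ⟨s₁, h1, h2⟩ : ∃ s₁, x :: s = a.toList ++ s₁ ∧ u = s₁ ++ s' := by
        cases a with
        | none => exact ⟨x :: s, by simp, by simpa using hs⟩
        | some a =>
          simp only [Option.toList_some, List.cons_append, List.nil_append, List.cons.injEq] at hs
          exact ⟨s, by simp [hs.1], hs.2⟩
      obtain ⟨r', t₁, t₂, rfl, hp1, hp2⟩ := ih h2
      refine ⟨r', b.toList ++ t₁, t₂, by simp, ?_, hp2⟩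
      rw [h1]
      exact .cons he hp1

/-- A subset construction: the invariant of `s` collects the vertices reached while reading `s`,
each with the left quotient of `Y` by the word written on the way. -/
theorem isRegular_preimage_path [Finite σ] (M : TransductionAutomaton α σ) (p q : σ)
    {Y : Language α} (hY : Y.IsRegular) :
    Language.IsRegular ({s | ∃ t ∈ Y, M.Path p q s t} : Language α) := by
  refine isRegular_of_invariant (β := Set (σ × Language α))
    (fun s => {x | ∃ t, M.Path p x.1 s t ∧ x.2 = Y.leftQuotient t})
    ((Set.finite_univ.prod hY.finite_range_leftQuotient).powerset.subset ?_) ?_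
  · rintro _ ⟨s, rfl⟩ ⟨r, Z⟩ ⟨t, -, rfl⟩
    exact ⟨trivial, t, rfl⟩
  · rintro u v huv y ⟨t, ht, hp⟩
    obtain ⟨r, t₁, t₂, rfl, h1, h2⟩ := hp.exists_split rfl
    have h3 : (r, Y.leftQuotient t₁) ∈ {x : σ × Language α | ∃ t, M.Path p x.1 u t ∧
        x.2 = Y.leftQuotient t} := ⟨t₁, h1, rfl⟩
    rw [huv] at h3
    obtain ⟨t₃, h4, h5⟩ := h3
    refine ⟨t₃ ++ t₂, ?_, h4.trans h2⟩
    have h6 : t₂ ∈ Y.leftQuotient t₁ := ht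
    rwa [show Y.leftQuotient t₁ = Y.leftQuotient t₃ from h5] at h6

/-- The words `u tʳ` for the labels `(u, t)` of the paths from `p` to a terminal vertex. -/
def linearLanguageFrom (M : TransductionAutomaton α σ) (p : σ) : Set (List α) :=
  {m | ∃ q ∈ M.terminal, ∃ u t, M.Path p q u t ∧ m = u ++ t.reverse}

theorem mem_linearLanguageFrom_of_path {p q : σ} {s t m : List α} (h : M.Path p q s t)
    (hm : m ∈ M.linearLanguageFrom q) : s ++ m ++ t.reverse ∈ M.linearLanguageFrom p := by
  obtain ⟨r, hr, u, t', hp, rfl⟩ := hm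
  exact ⟨r, hr, _, _, h.trans hp, by simp⟩

theorem exists_length_bound [Finite σ] (M : TransductionAutomaton α σ) :
    ∃ B : ℕ, ∀ q, ¬ (M.linearLanguageFrom q).Nontrivial →
      ∀ w ∈ M.linearLanguageFrom q, w.length ≤ B := by
  choose f hf using fun q => show ∃ n : ℕ, ¬ (M.linearLanguageFrom q).Nontrivial →
      ∀ w ∈ M.linearLanguageFrom q, w.length ≤ n by
    by_cases h : (M.linearLanguageFrom q).Nontrivial
    · exact ⟨0, fun h' => absurd h h'⟩
    · rcases (Set.not_nontrivial_iff.1 h).eq_empty_or_singleton with h1 | ⟨x, h1⟩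
      · exact ⟨0, fun _ w hw => by simp [h1] at hw⟩
      · exact ⟨x.length, fun _ w hw => by
          rw [h1, Set.mem_singleton_iff] at hw
          rw [hw]⟩
  obtain ⟨B, hB⟩ := (Set.finite_range f).bddAbove
  exact ⟨B, fun q hq w hw => (hf q hq w hw).trans (hB ⟨q, rfl⟩)⟩

/-- The path is followed as long as several words can still be produced. After the next edge the
rest has length at most `B`, and that edge adds at most one letter on each side, whence `B + 2`. -/
theorem exists_short_middle {B : ℕ}
    (hB : ∀ q, ¬ (M.linearLanguageFrom q).Nontrivial →
      ∀ w ∈ M.linearLanguageFrom q, w.length ≤ B) {p r : σ} {u t : List α}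
    (h : M.Path p r u t) (hr : r ∈ M.terminal) (hp : (M.linearLanguageFrom p).Nontrivial) :
    ∃ q s s' m, M.Path p q s s' ∧ (M.linearLanguageFrom q).Nontrivial ∧
      m ∈ M.linearLanguageFrom q ∧ m.length ≤ B + 2 ∧ u ++ t.reverse = s ++ m ++ s'.reverse := by
  induction h with
  | nil p => exact ⟨p, [], [], [], .nil p, hp, ⟨p, hr, [], [], .nil p, rfl⟩, by simp, rfl⟩
  | @cons p q r a b u t he hpath ih =>
    by_cases hq : (M.linearLanguageFrom q).Nontrivial
    · obtain ⟨q', s, s', m, h1, h2, h3, h4, h5⟩ := ih hr hq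
      refine ⟨q', _, _, m, .cons he h1, h2, h3, h4, ?_⟩
      have := congrArg (fun w => a.toList ++ w ++ b.toList.reverse) h5
      simpa using this
    · refine ⟨p, [], [], a.toList ++ u ++ (b.toList ++ t).reverse, .nil p, hp,
        ⟨r, hr, _, _, .cons he hpath, rfl⟩, ?_, by simp⟩
      have := hB q hq _ ⟨r, hr, u, t, hpath, rfl⟩
      have ha : a.toList.length ≤ 1 := by cases a <;> simp
      have hb : b.toList.length ≤ 1 := by cases b <;> simp
      simp only [List.length_append, List.length_reverse] at this ⊢
      omega

end TransductionAutomaton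

/-! ### From the vertices of a transduction to an automatic structure -/

section Decomposition

variable {X σ : Type*}

theorem invRev_map_invLetter (t : List (X × Bool)) :
    FreeGroup.invRev (t.map invLetter) = t.reverse := by
  rw [invRev_eq]
  simp [Function.comp_def]

theorem map_invLetter_map_invLetter (t : List (X × Bool)) :
    (t.map invLetter).map invLetter = t := by
  simp [Function.comp_def]

/-- The pairs `(s, v)` such that `(s, vʳ⁻¹)` labels a path to `p` from a vertex in `I`. If there is
only one word `u tʳ` such that `(u, t)` labels a path from `p` to a terminal vertex, only the empty
path is considered. -/
def branchRelation (M : TransductionAutomaton (X × Bool) σ) (I : Set σ) (p : σ)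
    (s v : List (X × Bool)) : Prop :=
  (∃ p₀ ∈ I, M.Path p₀ p s (v.map invLetter)) ∧
    ((M.linearLanguageFrom p).Nontrivial ∨ (p ∈ I ∧ s = [] ∧ v = []))

/-- Two words produced from `p` give two words of `S` with the same ends `s` and `v⁻¹`, so both ends
are shared. At the other vertices only empty ends are admitted, and these are always shared. -/
theorem isBranchDecomposition [Finite σ] (M : TransductionAutomaton (X × Bool) σ) (I : Set σ)
    {S : Set (List (X × Bool))} (hS : IsSignificant S)
    (hM : ∀ w, w ∈ S ↔ ∃ p ∈ I, w ∈ M.linearLanguageFrom p) {B : ℕ}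
    (hB : ∀ q, ¬ (M.linearLanguageFrom q).Nontrivial →
      ∀ w ∈ M.linearLanguageFrom q, w.length ≤ B) :
    IsBranchDecomposition S
      (fun i : (p : σ) × {m // m ∈ M.linearLanguageFrom p ∧ m.length ≤ B + 2} =>
        branchRelation M I i.1) (fun i => i.2.1) := by
  have hmem : ∀ p s v, (∃ p₀ ∈ I, M.Path p₀ p s (v.map invLetter)) →
      ∀ m ∈ M.linearLanguageFrom p, s ++ m ++ FreeGroup.invRev v ∈ S := by
    rintro p s v ⟨p₀, hp₀, hp⟩ m hm
    have := M.mem_linearLanguageFrom_of_path hp hm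
    exact (hM _).2 ⟨p₀, hp₀, this⟩
  constructor
  · intro w hw
    obtain ⟨p, hp, hwp⟩ := (hM w).1 hw
    by_cases h : (M.linearLanguageFrom p).Nontrivial
    · obtain ⟨r, hr, u, t, hpath, rfl⟩ := hwp
      obtain ⟨q, s, s', m, h1, h2, h3, h4, h5⟩ := M.exists_short_middle hB hpath hr h
      refine ⟨⟨q, m, h3, h4⟩, s, s'.map invLetter, ⟨⟨p, hp, ?_⟩, .inl h2⟩, ?_⟩
      · rwa [map_invLetter_map_invLetter]
      · rw [invRev_map_invLetter]; exact h5
    · refine ⟨⟨p, w, hwp, (hB p h w hwp).trans (by omega)⟩, [], [],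
        ⟨⟨p, hp, .nil p⟩, .inr ⟨hp, rfl, rfl⟩⟩, by simp⟩
  · rintro ⟨p, m, hm, hlen⟩ s v h
    exact hmem p s v h.1 m hm
  · rintro ⟨p, m, hm, hlen⟩ s v ⟨h, h' | ⟨-, rfl, rfl⟩⟩
    · obtain ⟨m₁, h1, m₂, h2, hne⟩ := h'
      exact ⟨_, hmem p s v h m₁ h1, _, hmem p s v h m₂ h2, by simpa using hne,
        by rw [List.append_assoc]; exact List.prefix_append _ _,
        by rw [List.append_assoc]; exact List.prefix_append _ _⟩
    · exact hS.nil_mem_branchPrefixes (hmem p _ _ h m hm)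
  · rintro ⟨p, m, hm, hlen⟩ s v ⟨h, h' | ⟨-, rfl, rfl⟩⟩
    · obtain ⟨m₁, h1, m₂, h2, hne⟩ := h'
      refine ⟨_, hS.symm _ (hmem p s v h m₁ h1), _, hS.symm _ (hmem p s v h m₂ h2), ?_, ?_, ?_⟩
      · rw [Ne, FreeGroup.invRev_injective.eq_iff]
        simpa using hne
      · rw [FreeGroup.invRev_append, FreeGroup.invRev_invRev]; exact List.prefix_append _ _
      · rw [FreeGroup.invRev_append, FreeGroup.invRev_invRev]; exact List.prefix_append _ _
    · exact hS.nil_mem_branchPrefixes (hmem p _ _ h m hm)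
  · rintro ⟨p, m, hm, hlen⟩ Y hY
    by_cases h : (M.linearLanguageFrom p).Nontrivial
    · have h1 := isRegular_iUnion (ι := I) fun p₀ =>
        M.isRegular_preimage_path p₀.1 p (isRegular_preimage_map hY invLetter)
      refine (congrArg Language.IsRegular ?_).mpr h1
      ext s
      constructor
      · rintro ⟨v, hv, ⟨p₀, hp₀, hp⟩, -⟩
        refine ⟨⟨p₀, hp₀⟩, v.map invLetter, ?_, hp⟩
        change (v.map invLetter).map invLetter ∈ Y
        rwa [map_invLetter_map_invLetter]
      · rintro ⟨⟨p₀, hp₀⟩, t, ht, hp⟩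
        refine ⟨t.map invLetter, ht, ⟨p₀, hp₀, ?_⟩, .inl h⟩
        rwa [map_invLetter_map_invLetter]
    · refine isRegular_of_subset_nil ?_
      rintro s ⟨v, -, -, h' | ⟨-, h', -⟩⟩
      · exact absurd h' h
      · exact h'

open Classical in
/-- The value of the words `u tʳ`, where `(u, t)` labels a path from `p` to a terminal vertex, in
case that it is unique. -/
noncomputable def vertexValue {G : Type*} [Group G] (μ : FreeGroup X →* G)
    (M : TransductionAutomaton (X × Bool) σ) (p : σ) : G :=
  if h : (M.linearLanguageFrom p).Nonempty then μ (FreeGroup.mk h.some) else 1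

/-- If `s m v⁻¹` is trivial in `G`, then `m` has the value `s⁻¹ v`, which is the current difference.
So the difference at a vertex is the common value of all words produced from it. -/
theorem exists_fellowTravel_of_path [Finite X] [Finite σ] {G : Type*} [Group G]
    (μ : FreeGroup X →* G) (M : TransductionAutomaton (X × Bool) σ) (I : Set σ)
    (hM : ∀ p ∈ I, ∀ w ∈ M.linearLanguageFrom p, μ (FreeGroup.mk w) = 1) :
    ∃ E : Set G, E.Finite ∧ ∀ p₀ ∈ I, ∀ p s v, M.Path p₀ p s (v.map invLetter) →
      (M.linearLanguageFrom p).Nonempty → FellowTravel μ E 1 s v := by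
  have emul : ∀ c d : List (X × Bool), μ (FreeGroup.mk (c ++ d)) =
      μ (FreeGroup.mk c) * μ (FreeGroup.mk d) := fun c d => by
    rw [← map_mul, FreeGroup.mul_mk]
  set R : Set G := Set.range (vertexValue μ M) with hR
  have hval : ∀ p₀ ∈ I, ∀ p s t, M.Path p₀ p s t → ∀ m ∈ M.linearLanguageFrom p,
      vertexValue μ M p = μ (FreeGroup.mk m) := by
    intro p₀ hp₀ p s t hp m hm
    have h1 : (M.linearLanguageFrom p).Nonempty := ⟨m, hm⟩
    have h2 := hM p₀ hp₀ _ (M.mem_linearLanguageFrom_of_path hp hm)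
    have h3 := hM p₀ hp₀ _ (M.mem_linearLanguageFrom_of_path hp h1.some_mem)
    rw [emul, emul] at h2 h3
    rw [vertexValue, dif_pos h1]
    exact mul_left_cancel (mul_right_cancel (h3.trans h2.symm))
  -- The second set contains the differences halfway along an edge with a letter on both sides.
  refine ⟨R ∪ Set.image2 (fun a g => (μ (FreeGroup.mk [a]))⁻¹ * g) Set.univ R,
    (Set.finite_range _).union (Set.Finite.image2 _ Set.finite_univ (Set.finite_range _)), ?_⟩
  set E := R ∪ Set.image2 (fun a g => (μ (FreeGroup.mk [a]))⁻¹ * g) Set.univ R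
  have key : ∀ {p q : σ} {s t : List (X × Bool)}, M.Path p q s t →
      (M.linearLanguageFrom q).Nonempty → (∃ p₀ ∈ I, ∃ s₀ t₀, M.Path p₀ p s₀ t₀) →
      FellowTravel μ E (vertexValue μ M p) s (t.map invLetter) := by
    intro p q s t h
    induction h with
    | nil p => exact fun _ _ => .nil (.inl ⟨p, rfl⟩)
    | @cons p q r a b u t he hpath ih =>
      rintro ⟨m, hm⟩ ⟨p₀, hp₀, s₀, t₀, h0⟩
      have h1 : M.Path p q (a.toList ++ []) (b.toList ++ []) := .cons he (.nil q)
      have h2 := M.mem_linearLanguageFrom_of_path hpath hm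
      have h3 := hval p₀ hp₀ q _ _ (h0.trans h1) _ h2
      have h4 := hval p₀ hp₀ p _ _ h0 _ (M.mem_linearLanguageFrom_of_path h1 h2)
      have h5 := ih ⟨m, hm⟩ ⟨p₀, hp₀, _, _, h0.trans h1⟩
      have h6 : vertexValue μ M q = (μ (FreeGroup.mk a.toList))⁻¹ * vertexValue μ M p *
          (μ (FreeGroup.mk b.toList.reverse))⁻¹ := by
        rw [h4, emul, emul, h3]
        simp [mul_assoc]
      have hpE : vertexValue μ M p ∈ E := .inl ⟨p, rfl⟩
      cases a with
      | none =>
        cases b with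
        | none =>
          have : vertexValue μ M q = vertexValue μ M p := by
            rw [h6]; simp [← FreeGroup.one_eq_mk]
          rw [this] at h5
          exact h5
        | some b =>
          refine .right hpE ?_
          rw [mk_invLetter, map_inv]
          have : vertexValue μ M q = vertexValue μ M p * (μ (FreeGroup.mk [b]))⁻¹ := by
            rw [h6]; simp [← FreeGroup.one_eq_mk]
          rwa [this] at h5
      | some a =>
        cases b with
        | none =>
          refine .left hpE ?_
          have : vertexValue μ M q = (μ (FreeGroup.mk [a]))⁻¹ * vertexValue μ M p := by
            rw [h6]; simp [← FreeGroup.one_eq_mk]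
          rwa [this] at h5
        | some b =>
          refine .left hpE (.right (.inr ⟨a, trivial, _, ⟨p, rfl⟩, rfl⟩) ?_)
          rw [mk_invLetter, map_inv]
          have : vertexValue μ M q = (μ (FreeGroup.mk [a]))⁻¹ * vertexValue μ M p *
              (μ (FreeGroup.mk [b]))⁻¹ := by
            rw [h6]; simp
          rwa [this] at h5
  intro p₀ hp₀ p s v hp hne
  have h1 := key hp hne ⟨p₀, hp₀, [], [], .nil p₀⟩
  obtain ⟨m, hm⟩ := hne
  have h2 := M.mem_linearLanguageFrom_of_path hp hm
  rw [map_invLetter_map_invLetter, hval p₀ hp₀ p₀ [] [] (.nil p₀) _ h2, hM p₀ hp₀ _ h2] at h1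
  exact h1

/-- A significant set that is a finite union of linear languages and whose image generates the kernel
of a homomorphism onto `G` yields a prefix-closed asynchronous automatic structure with uniqueness. -/
theorem hasPrefixClosedAsyncStructureWithUniqueness_of_isSignificant {X : Type} [Finite X] {σ : Type*}
    [Finite σ] {G : Type} [Group G] {μ : FreeGroup X →* G} (hμ : Function.Surjective μ)
    (M : TransductionAutomaton (X × Bool) σ) (I : Set σ) {S : Set (List (X × Bool))}
    (hS : IsSignificant S) (hM : ∀ w, w ∈ S ↔ ∃ p ∈ I, w ∈ M.linearLanguageFrom p)
    (hker : Subgroup.closure (FreeGroup.mk '' S) = μ.ker) :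
    HasPrefixClosedAsyncStructureWithUniqueness G := by
  obtain ⟨B, hB⟩ := M.exists_length_bound
  have hdec := isBranchDecomposition M I hS hM hB
  have hSker : ∀ w ∈ S, μ (FreeGroup.mk w) = 1 := fun w hw => by
    rw [← MonoidHom.mem_ker, ← hker]
    exact Subgroup.subset_closure ⟨w, hw, rfl⟩
  obtain ⟨E, hE, hft⟩ := exists_fellowTravel_of_path μ M I
    fun p hp w hw => hSker w ((hM w).2 ⟨p, hp, hw⟩)
  have : ∀ p, Finite {m // m ∈ M.linearLanguageFrom p ∧ m.length ≤ B + 2} := fun p =>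
    ((List.finite_length_le (X × Bool) (B + 2)).subset fun m hm => hm.2).to_subtype
  obtain ⟨E', hE', hft'⟩ := hdec.exists_fellowTravel hS hE
    (fun i s v ⟨⟨p₀, hp₀, h⟩, _⟩ => hft p₀ hp₀ _ s v h ⟨_, i.2.2.1⟩)
  have hm1 : ∀ u a v, marking S u a v → μ (FreeGroup.mk (u ++ a :: FreeGroup.invRev v)) = 1 :=
    fun u a v h => hSker _ h.1
  have hker' : μ.ker ≤ Subgroup.closure {g | ∃ u a v, marking S u a v ∧
      FreeGroup.mk (u ++ a :: FreeGroup.invRev v) = g} := by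
    rw [← hker]
    refine Subgroup.closure_mono ?_
    rintro _ ⟨w, hw, rfl⟩
    obtain ⟨u, a, v, h, rfl⟩ := hS.exists_marking hw
    exact ⟨u, a, v, h, rfl⟩
  exact ⟨X, inferInstance, μ, avoiding (marking S), hμ,
    hS.isMarking.isAsyncAutomaticStructure_avoiding hμ hm1 hker'
      (isRegular_avoiding (hdec.isRegular_marking hS)) hE' hft',
    IsMarking.isPrefixClosed_avoiding, fun u hu v hv h => hS.isMarking.eq_of_map_eq hker' hu hv h⟩

end Decomposition

/-! ### From significant letters to the overlap condition -/

section SignificantLetters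

variable {X : Type*}

theorem norm_mk_of_isReduced [DecidableEq X] {w : List (X × Bool)} (h : FreeGroup.IsReduced w) :
    (FreeGroup.mk w).norm = w.length := by
  rw [FreeGroup.norm, FreeGroup.toWord_mk, h.reduce_eq]

theorem MarkedWord.inv_word (m : MarkedWord X) : m.inv.word = FreeGroup.invRev m.word := by
  rw [word, word, FreeGroup.invRev_append, invRev_cons']
  simp [inv, invLetter]

theorem MarkedWord.inv_inv (m : MarkedWord X) : m.inv.inv = m := by
  simp [inv]

/-- A length count. Cancelling `z` bounds the reduced product from above; on the other hand `y`
represents `m₁.post` times `m₂.pre`, so its length is at least `m₁.post.length - m₂.pre.length`. -/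
theorem MarkedWord.Unaffected.length_le {m₁ m₂ : MarkedWord X} (h : m₁.Unaffected m₂)
    (h1 : FreeGroup.IsReduced m₁.word) {z : List (X × Bool)}
    (hz1 : z <+: FreeGroup.invRev m₁.word) (hz2 : z <+: m₂.word) : z.length ≤ m₂.pre.length := by
  classical
  obtain ⟨y, hy, hred⟩ := h
  obtain ⟨r₁, hr₁⟩ := hz1
  obtain ⟨r₂, hr₂⟩ := hz2
  have hmky : FreeGroup.mk y = FreeGroup.mk m₁.post * FreeGroup.mk m₂.pre := by
    rw [FreeGroup.mul_mk]
    exact FreeGroup.Red.exact.2 ⟨y, .refl, hy⟩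
  have e1 : FreeGroup.mk (m₁.pre ++ m₁.letter :: (y ++ m₂.letter :: m₂.post)) =
      FreeGroup.mk (FreeGroup.invRev r₁ ++ r₂) := by
    have hw1 : m₁.word = FreeGroup.invRev r₁ ++ FreeGroup.invRev z := by
      rw [← FreeGroup.invRev_append, hr₁, FreeGroup.invRev_invRev]
    have : FreeGroup.mk (m₁.pre ++ m₁.letter :: (y ++ m₂.letter :: m₂.post)) =
        FreeGroup.mk m₁.word * FreeGroup.mk m₂.word := by
      rw [MarkedWord.word, MarkedWord.word, ← FreeGroup.mul_mk, ← FreeGroup.mul_mk,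
        ← FreeGroup.mul_mk, mk_cons, mk_cons m₁.letter m₁.post, ← FreeGroup.mul_mk, hmky]
      simp only [mul_assoc]
    rw [this, hw1, ← hr₂, ← FreeGroup.mul_mk, ← FreeGroup.mul_mk, ← FreeGroup.mul_mk,
      ← FreeGroup.inv_mk (L := z), mul_assoc, inv_mul_cancel_left]
  have e2 : (m₁.pre ++ m₁.letter :: (y ++ m₂.letter :: m₂.post)).length ≤
      (FreeGroup.invRev r₁ ++ r₂).length := by
    rw [← norm_mk_of_isReduced hred, e1]
    exact FreeGroup.norm_mk_le
  have e3 : m₁.post.length ≤ y.length + m₂.pre.length := by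
    have hp : FreeGroup.IsReduced m₁.post :=
      h1.infix ⟨m₁.pre ++ [m₁.letter], [], by simp [MarkedWord.word]⟩
    rw [← norm_mk_of_isReduced hp, ← mul_inv_cancel_right (FreeGroup.mk m₁.post)
      (FreeGroup.mk m₂.pre), ← hmky]
    refine (FreeGroup.norm_mul_le _ _).trans ?_
    rw [FreeGroup.norm_inv_eq]
    exact add_le_add FreeGroup.norm_mk_le FreeGroup.norm_mk_le
  have l1 := congrArg List.length hr₁
  have l2 := congrArg List.length hr₂
  simp only [List.length_append, List.length_cons, FreeGroup.invRev_length, MarkedWord.word] at *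
  omega

/-- A common prefix of `w` and another word `w'` cancels in `w'⁻¹ w`, so it ends before the
significant letter of `w`. The same holds for `w⁻¹`, and the letter itself makes the inequality
strict. -/
theorem HasSignificantLetters.isSignificant {L : Language (X × Bool)}
    (hL : HasSignificantLetters L) : IsSignificant {w | w ∈ L ∨ FreeGroup.invRev w ∈ L} := by
  obtain ⟨hred, hnil, d, hd, hsig⟩ := hL
  set S : Set (List (X × Bool)) := {w | w ∈ L ∨ FreeGroup.invRev w ∈ L} with hS
  have hSred : ∀ w ∈ S, FreeGroup.IsReduced w := by
    rintro w (hw | hw)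
    · exact hred w hw
    · simpa using isReduced_invRev (hred _ hw)
  have hsymm : ∀ w ∈ S, FreeGroup.invRev w ∈ S := by
    rintro w (hw | hw)
    · exact .inr (by simpa using hw)
    · exact .inl hw
  have hmark : ∀ w ∈ S, ∃ w₁ ∈ L, ∃ ε, ((d w₁).signed ε).word = w := by
    rintro w (hw | hw)
    · exact ⟨w, hw, true, hd w hw⟩
    · refine ⟨_, hw, false, ?_⟩
      change (d _).inv.word = _
      rw [MarkedWord.inv_word, hd _ hw, FreeGroup.invRev_invRev]
  have key : ∀ w₁ ∈ L, ∀ ε, ((d w₁).signed ε).word ∈ S → ∀ w' ∈ S, w' ≠ ((d w₁).signed ε).word →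
      ∀ z, z <+: ((d w₁).signed ε).word → z <+: w' → z.length ≤ ((d w₁).signed ε).pre.length := by
    intro w₁ h1 ε hw w' hw' hne z hz hz'
    obtain ⟨w₂, h2, ε', he⟩ := hmark _ (hsymm _ hw')
    rcases hsig w₂ h2 w₁ h1 ε' ε with h | h
    · refine absurd (eq_of_mk_eq (hSred _ hw') (hSred _ hw) ?_) hne
      have h3 : FreeGroup.mk (((d w₂).signed ε').word ++ ((d w₁).signed ε).word) = 1 := by
        rw [FreeGroup.one_eq_mk]
        exact FreeGroup.Red.exact.2 ⟨[], h, .refl⟩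
      rw [he, ← FreeGroup.mul_mk, ← FreeGroup.inv_mk, inv_mul_eq_one] at h3
      exact h3
    · exact h.length_le (he ▸ hSred _ (hsymm _ hw'))
        (by rwa [he, FreeGroup.invRev_invRev]) hz
  refine ⟨hSred, ?_, hsymm, ?_⟩
  · rintro (h | h)
    · exact hnil h
    · exact hnil h
  · intro w hw w₁ hw₁ w₂ hw₂ hne₁ hne₂ y z hy hy₁ hz hz₂
    obtain ⟨w₀, h0, ε, rfl⟩ := hmark w hw
    have e1 := key w₀ h0 ε hw w₁ hw₁ hne₁ y hy hy₁
    have e0 : (d w₀).signed (!ε) = ((d w₀).signed ε).inv := by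
      cases ε
      · exact (MarkedWord.inv_inv _).symm
      · rfl
    have e2 := key w₀ h0 (!ε) (by rw [e0, MarkedWord.inv_word]; exact hsymm _ hw) w₂ hw₂
      (by rwa [e0, MarkedWord.inv_word]) z (by rwa [e0, MarkedWord.inv_word]) hz₂
    rw [e0] at e2
    simp only [MarkedWord.inv, FreeGroup.invRev_length] at e2
    rw [MarkedWord.word]
    simp only [List.length_append, List.length_cons]
    omega

end SignificantLetters

/-! ### Adjoining the inverses to a linear language -/

namespace TransductionAutomaton

variable {X σ : Type*}

/-- Two copies of `M`, the second one with labels `(a, b)` replaced by `(b⁻¹, a⁻¹)`. -/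
def withInverse (M : TransductionAutomaton (X × Bool) σ) :
    TransductionAutomaton (X × Bool) (σ × Bool) where
  edge p a b q := p.2 = q.2 ∧
    ((p.2 = true ∧ M.edge p.1 a b q.1) ∨
      (p.2 = false ∧ ∃ a' b', M.edge p.1 a' b' q.1 ∧ a = b'.map invLetter ∧ b = a'.map invLetter))
  start := (M.start, true)
  terminal := {q | q.1 ∈ M.terminal}

variable {M : TransductionAutomaton (X × Bool) σ}

theorem Path.withInverse_true {p q : σ} {u t : List (X × Bool)} (h : M.Path p q u t) :
    M.withInverse.Path (p, true) (q, true) u t := by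
  induction h with
  | nil => exact .nil _
  | @cons p q r a b u t he _ ih =>
    exact .cons (q := (q, true)) ⟨rfl, .inl ⟨rfl, he⟩⟩ ih

/-- The inverse of `u tʳ` is again of this form, with the letterwise inverses of `t` and `u` in
place of `u` and `t`. -/
theorem Path.withInverse_false {p q : σ} {u t : List (X × Bool)} (h : M.Path p q u t) :
    M.withInverse.Path (p, false) (q, false) (t.map invLetter) (u.map invLetter) := by
  induction h with
  | nil => exact .nil _
  | @cons p q r a b u t he _ ih =>
    have : M.withInverse.edge (p, false) (b.map invLetter) (a.map invLetter) (q, false) :=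
      ⟨rfl, .inr ⟨rfl, a, b, he, rfl, rfl⟩⟩
    have h2 := Path.cons this ih
    cases a <;> cases b <;> simpa using h2

theorem Path.of_withInverse {P Q : σ × Bool} {u t : List (X × Bool)}
    (h : M.withInverse.Path P Q u t) : (P.2 = true → M.Path P.1 Q.1 u t) ∧
      (P.2 = false → M.Path P.1 Q.1 (t.map invLetter) (u.map invLetter)) := by
  induction h with
  | nil => exact ⟨fun _ => .nil _, fun _ => .nil _⟩
  | @cons p q r a b u t he _ ih =>
    obtain ⟨h1, ⟨h2, h3⟩ | ⟨h2, a', b', h3, rfl, rfl⟩⟩ := he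
    · exact ⟨fun _ => .cons h3 (ih.1 (h1 ▸ h2)), fun h => by simp_all⟩
    · refine ⟨fun h => by simp_all, fun _ => ?_⟩
      have h4 := Path.cons h3 (ih.2 (h1 ▸ h2))
      cases a' <;> cases b' <;> simpa using h4

theorem mem_withInverse_iff (M : TransductionAutomaton (X × Bool) σ) (w : List (X × Bool)) :
    (∃ p ∈ ({p | p.1 = M.start} : Set (σ × Bool)), w ∈ M.withInverse.linearLanguageFrom p) ↔
      w ∈ M.linearLanguageFrom M.start ∨ FreeGroup.invRev w ∈ M.linearLanguageFrom M.start := by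
  constructor
  · rintro ⟨⟨_, b⟩, rfl, q, hq, u, t, hp, rfl⟩
    cases b with
    | true => exact .inl ⟨q.1, hq, u, t, hp.of_withInverse.1 rfl, rfl⟩
    | false =>
      refine .inr ⟨q.1, hq, _, _, hp.of_withInverse.2 rfl, ?_⟩
      rw [FreeGroup.invRev_append, ← invRev_map_invLetter t, FreeGroup.invRev_invRev, invRev_eq]
  · rintro (⟨q, hq, u, t, hp, rfl⟩ | ⟨q, hq, u, t, hp, h⟩)
    · exact ⟨(M.start, true), rfl, (q, true), hq, u, t, hp.withInverse_true, rfl⟩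
    · refine ⟨(M.start, false), rfl, (q, false), hq, _, _, hp.withInverse_false, ?_⟩
      rw [← FreeGroup.invRev_invRev (L₁ := w), h, FreeGroup.invRev_append, invRev_eq u,
        ← invRev_map_invLetter t, FreeGroup.invRev_invRev]

end TransductionAutomaton

theorem HasPrefixClosedAsyncStructureWithUniqueness.of_mulEquiv {G H : Type*} [Group G] [Group H]
    (e : H ≃* G) (h : HasPrefixClosedAsyncStructureWithUniqueness H) :
    HasPrefixClosedAsyncStructureWithUniqueness G := by
  obtain ⟨X, hX, μ, C, hsurj, hstr, hpre, huniq⟩ := h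
  refine ⟨X, hX, e.toMonoidHom.comp μ, C, e.surjective.comp hsurj, ⟨hstr.regular, fun g => ?_,
    fun x => ?_⟩, hpre, fun u hu v hv h => huniq u hu v hv (e.injective h)⟩
  · obtain ⟨w, hw, h⟩ := hstr.onto (e.symm g)
    exact ⟨w, hw, by simp [h]⟩
  · obtain ⟨σ, hσ, M, hM⟩ := hstr.multiplier x
    refine ⟨σ, hσ, M, fun u v => ?_⟩
    rw [hM]
    simp

theorem HasSignificantLetters.hasPrefixClosedAsyncStructureWithUniqueness {X : Type} [Finite X]
    {N : Subgroup (FreeGroup X)} [N.Normal] {L : Language (X × Bool)} (hlin : IsLinearLanguage L)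
    (hL : HasSignificantLetters L)
    (hN : Subgroup.closure {g : FreeGroup X | ∃ w ∈ L, FreeGroup.mk w = g} = N) :
    HasPrefixClosedAsyncStructureWithUniqueness (FreeGroup X ⧸ N) := by
  obtain ⟨_, ⟨σ, hσ, M, rfl⟩, hM⟩ := hlin
  have hLM : ∀ w, w ∈ L ↔ w ∈ M.linearLanguageFrom M.start := fun w => by
    rw [hM]
    constructor
    · rintro ⟨u, v, ⟨q, hq, h⟩, rfl⟩
      exact ⟨q, hq, u, v, h, rfl⟩
    · rintro ⟨q, hq, u, v, h, rfl⟩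
      exact ⟨u, v, ⟨q, hq, h⟩, rfl⟩
  refine hasPrefixClosedAsyncStructureWithUniqueness_of_isSignificant
    (QuotientGroup.mk'_surjective N) M.withInverse {p | p.1 = M.start} hL.isSignificant
    (fun w => ?_) ?_
  · rw [M.mem_withInverse_iff, ← hLM, ← hLM]
    rfl
  · rw [QuotientGroup.ker_mk']
    apply le_antisymm
    · rw [Subgroup.closure_le]
      rintro _ ⟨w, hw | hw, rfl⟩
      · rw [← hN]
        exact Subgroup.subset_closure ⟨w, hw, rfl⟩
      · rw [SetLike.mem_coe, ← inv_mem_iff, FreeGroup.inv_mk, ← hN]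
        exact Subgroup.subset_closure ⟨_, hw, rfl⟩
    · rw [← hN]
      refine Subgroup.closure_mono ?_
      rintro _ ⟨w, hw, rfl⟩
      exact ⟨w, .inl hw, rfl⟩

/-! ### Schreier generators: significant letters and generation of the kernel -/

/-- The nontrivial Schreier generators `u a v⁻¹` for a set `C` of representatives. -/
def IsSchreierTriple {X G : Type*} [Group G] (μ : FreeGroup X →* G) (C : Language (X × Bool))
    (u : List (X × Bool)) (a : X × Bool) (v : List (X × Bool)) : Prop :=
  u ∈ C ∧ v ∈ C ∧ u ++ [a] ∉ C ∧ v ++ [invLetter a] ∉ C ∧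
    μ (FreeGroup.mk (u ++ [a])) = μ (FreeGroup.mk v)

/-- The words `u a v⁻¹` for the nontrivial Schreier generators. -/
def schreierLanguage {X G : Type*} [Group G] (μ : FreeGroup X →* G) (C : Language (X × Bool)) :
    Language (X × Bool) :=
  {w | ∃ u a v, IsSchreierTriple μ C u a v ∧ w = u ++ a :: FreeGroup.invRev v}

theorem exists_longest_common_prefix {α : Type*} : ∀ u v : List α, ∃ z p q, u = z ++ p ∧
    v = z ++ q ∧ ∀ b p' q', p = b :: p' → q = b :: q' → False
  | [], v => ⟨[], [], v, rfl, rfl, by simp⟩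
  | a :: u, [] => ⟨[], a :: u, [], rfl, rfl, by simp⟩
  | a :: u, b :: v => by
    by_cases h : a = b
    · obtain ⟨z, p, q, rfl, rfl, h'⟩ := exists_longest_common_prefix u v
      exact ⟨a :: z, p, q, rfl, by rw [h]; rfl, h'⟩
    · refine ⟨[], a :: u, b :: v, rfl, rfl, fun c p' q' h1 h2 => h ?_⟩
      rw [List.cons_eq_cons] at h1 h2
      exact h1.1.trans h2.1.symm

namespace IsSchreierTriple

variable {X G : Type*} [Group G] {μ : FreeGroup X →* G} {C : Language (X × Bool)}
  {u v u' v' : List (X × Bool)} {a a' : X × Bool}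

theorem map_concat_eq {c d : List (X × Bool)}
    (h : μ (FreeGroup.mk (c ++ [a])) = μ (FreeGroup.mk d)) :
    μ (FreeGroup.mk (d ++ [invLetter a])) = μ (FreeGroup.mk c) := by
  rw [← FreeGroup.mul_mk, mk_invLetter, map_mul, ← h, ← FreeGroup.mul_mk, map_mul, map_inv,
    mul_inv_cancel_right]

theorem symm (h : IsSchreierTriple μ C u a v) : IsSchreierTriple μ C v (invLetter a) u :=
  ⟨h.2.1, h.1, h.2.2.2.1, by rw [invLetter_invLetter]; exact h.2.2.1, map_concat_eq h.2.2.2.2⟩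

/-- The prefixes before and after a cancelling pair would be two representatives of one element. -/
theorem isReduced_of_mem (hpre : IsPrefixClosed C)
    (huniq : ∀ u ∈ C, ∀ v ∈ C, μ (FreeGroup.mk u) = μ (FreeGroup.mk v) → u = v) {c : List (X × Bool)}
    (hc : c ∈ C) : FreeGroup.IsReduced c := by
  rw [FreeGroup.isReduced_iff_not_step]
  rintro _ @⟨L₁, L₂, x, b⟩
  have h1 : L₁ ∈ C := hpre _ hc _ (List.prefix_append _ _)
  have h2 : L₁ ++ [(x, b), (x, !b)] ∈ C := hpre _ hc _ ⟨L₂, by simp⟩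
  have := huniq _ h1 _ h2 (congrArg μ (FreeGroup.Red.exact.2
    ⟨L₁, .refl, (FreeGroup.Red.Step.to_red (by
      simpa using FreeGroup.Red.Step.not (L₁ := L₁) (L₂ := []) (x := x) (b := b)))⟩))
  simp at this

/-- If `u` ended in the inverse of `a`, the rest of `u` would be `v` by uniqueness, and then `v ++
[invLetter a] = u` would be in `C`. The other junction is treated by the inverse triple. -/
theorem isReduced (h : IsSchreierTriple μ C u a v) (hpre : IsPrefixClosed C)
    (huniq : ∀ u ∈ C, ∀ v ∈ C, μ (FreeGroup.mk u) = μ (FreeGroup.mk v) → u = v) :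
    FreeGroup.IsReduced (u ++ a :: FreeGroup.invRev v) := by
  have hua : ∀ {u v a}, IsSchreierTriple μ C u a v → FreeGroup.IsReduced (u ++ [a]) := by
    intro u v a h
    refine isReduced_append (isReduced_of_mem hpre huniq h.1) .singleton fun c b v₁ h1 h2 => ?_
    rw [List.cons_eq_cons] at h2
    obtain rfl : b = invLetter a := by rw [h2.1, invLetter_invLetter]
    have h3 : c ∈ C := hpre _ h.1 _ (h1 ▸ List.prefix_append _ _)
    have h4 : c = v := by
      refine huniq _ h3 _ h.2.1 ?_
      rw [← h.2.2.2.2, h1, ← FreeGroup.mul_mk, ← FreeGroup.mul_mk, mk_invLetter,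
        inv_mul_cancel_right]
    exact h.2.2.2.1 (by rw [← h4, ← h1]; exact h.1)
  have h1 : FreeGroup.IsReduced ([a] ++ FreeGroup.invRev v) := by
    have := isReduced_invRev (hua h.symm)
    rwa [invRev_concat, invLetter_invLetter] at this
  have := (hua h).append_overlap h1 (by simp)
  simpa using this

/-- Once the longest common prefix of `v` and `u'` is cancelled, a further cancellation would extend
this prefix, or make `v a⁻¹` a prefix of `u'`, or `u' a'` a prefix of `v`, or make the two words
inverse to each other. -/
theorem unaffected (h : IsSchreierTriple μ C u a v) (h' : IsSchreierTriple μ C u' a' v')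
    (hpre : IsPrefixClosed C)
    (huniq : ∀ u ∈ C, ∀ v ∈ C, μ (FreeGroup.mk u) = μ (FreeGroup.mk v) → u = v) :
    FreeGroup.Red ((u ++ a :: FreeGroup.invRev v) ++ (u' ++ a' :: FreeGroup.invRev v')) [] ∨
      (MarkedWord.mk u a (FreeGroup.invRev v)).Unaffected
        (MarkedWord.mk u' a' (FreeGroup.invRev v')) := by
  classical
  by_cases htriv : u' = v ∧ a' = invLetter a
  · left
    obtain ⟨rfl, rfl⟩ := htriv
    obtain rfl : u = v' := huniq _ h.1 _ h'.2.1 (h.symm.2.2.2.2.symm.trans h'.2.2.2.2)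
    have e : u ++ a :: FreeGroup.invRev u' =
        FreeGroup.invRev (u' ++ invLetter a :: FreeGroup.invRev u) := by
      rw [FreeGroup.invRev_append, invRev_cons', FreeGroup.invRev_invRev]
      simp
    rw [e, ← FreeGroup.reduce_invRev_left_cancel
      (L := u' ++ invLetter a :: FreeGroup.invRev u)]
    exact FreeGroup.reduce.red
  right
  obtain ⟨z, p, q, hv, hu', hpq⟩ := exists_longest_common_prefix v u'
  refine ⟨FreeGroup.invRev p ++ q, ?_, ?_⟩
  · change FreeGroup.Red (FreeGroup.invRev v ++ u') _
    have hz : FreeGroup.Red (FreeGroup.invRev z ++ z) [] := by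
      have := FreeGroup.reduce.red (L := FreeGroup.invRev z ++ z)
      rwa [FreeGroup.reduce_invRev_left_cancel] at this
    have := (FreeGroup.Red.append_append (FreeGroup.Red.refl (L := FreeGroup.invRev p)) hz).append_append
      (FreeGroup.Red.refl (L := q))
    rw [hv, hu', FreeGroup.invRev_append]
    simpa using this
  · change FreeGroup.IsReduced (u ++ a :: ((FreeGroup.invRev p ++ q) ++ a' :: FreeGroup.invRev v'))
    have h1 : FreeGroup.IsReduced (u ++ a :: FreeGroup.invRev p) := by
      refine (h.isReduced hpre huniq).infix ⟨[], FreeGroup.invRev z, ?_⟩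
      rw [hv, FreeGroup.invRev_append]
      simp
    have h2 : FreeGroup.IsReduced (q ++ a' :: FreeGroup.invRev v') := by
      refine (h'.isReduced hpre huniq).infix ⟨z, [], ?_⟩
      rw [hu']
      simp
    have := isReduced_append h1 h2 fun w b w' e1 e2 => by
      cases p with
      | nil =>
        obtain rfl : a = b := by
          have : u ++ [a] = w ++ [b] := e1
          simpa using (List.append_inj' this rfl).2
        cases q with
        | nil =>
          rw [List.nil_append, List.cons_eq_cons] at e2
          exact htriv ⟨by rw [hu', hv], e2.1⟩
        | cons c q =>
          rw [List.cons_append, List.cons_eq_cons] at e2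
          refine h.2.2.2.1 (hpre _ h'.1 _ ⟨q, ?_⟩)
          rw [hu', hv, e2.1]
          simp
      | cons c p =>
        obtain rfl : invLetter c = b := by
          rw [invRev_cons', ← List.cons_append, ← List.append_assoc] at e1
          simpa using (List.append_inj' e1 rfl).2
        rw [invLetter_invLetter] at e2
        cases q with
        | nil =>
          rw [List.nil_append, List.cons_eq_cons] at e2
          refine h'.2.2.1 (hpre _ h.2.1 _ ⟨p, ?_⟩)
          rw [hu', hv, e2.1]
          simp
        | cons c' q =>
          rw [List.cons_append, List.cons_eq_cons] at e2
          exact hpq c p q rfl (by rw [e2.1])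
    simpa using this

end IsSchreierTriple

section Schreier

variable {X G : Type*} [Group G] {μ : FreeGroup X →* G} {C : Language (X × Bool)}

theorem hasSignificantLetters_schreierLanguage [Nonempty X] (hpre : IsPrefixClosed C)
    (huniq : ∀ u ∈ C, ∀ v ∈ C, μ (FreeGroup.mk u) = μ (FreeGroup.mk v) → u = v) :
    HasSignificantLetters (schreierLanguage μ C) := by
  refine ⟨?_, ?_, ?_⟩
  · rintro _ ⟨u, a, v, h, rfl⟩
    exact h.isReduced hpre huniq
  · rintro ⟨u, a, v, h, he⟩
    simp at he
  have hd : ∀ w, ∃ m : MarkedWord X, w ∈ schreierLanguage μ C → m.word = w ∧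
      ∃ u a v, IsSchreierTriple μ C u a v ∧ m = ⟨u, a, FreeGroup.invRev v⟩ := by
    intro w
    by_cases hw : w ∈ schreierLanguage μ C
    · obtain ⟨u, a, v, h, rfl⟩ := hw
      exact ⟨⟨u, a, FreeGroup.invRev v⟩, fun _ => ⟨rfl, u, a, v, h, rfl⟩⟩
    -- Words outside the language need a default mark, hence a letter.
    · exact ⟨⟨[], (Classical.arbitrary X, true), []⟩, fun h => absurd h hw⟩
  choose d hd using hd
  refine ⟨d, fun w hw => (hd w hw).1, fun w₁ h1 w₂ h2 ε₁ ε₂ => ?_⟩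
  have hsigned : ∀ w ∈ schreierLanguage μ C, ∀ ε, ∃ u a v, IsSchreierTriple μ C u a v ∧
      (d w).signed ε = ⟨u, a, FreeGroup.invRev v⟩ := by
    intro w hw ε
    obtain ⟨-, u, a, v, h, he⟩ := hd w hw
    cases ε with
    | true => exact ⟨u, a, v, h, he⟩
    | false =>
      refine ⟨v, invLetter a, u, h.symm, ?_⟩
      change (d w).inv = _
      rw [he]
      simp [MarkedWord.inv, invLetter]
  obtain ⟨u, a, v, h, e⟩ := hsigned w₁ h1 ε₁
  obtain ⟨u', a', v', h', e'⟩ := hsigned w₂ h2 ε₂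
  rw [e, e']
  exact h.unaffected h' hpre huniq

/-- Schreier's argument: reading `w` letter by letter and replacing each prefix by its
representative gives a product of elements `c₀ a c⁻¹`, each of them a generator or trivial in the
free group. -/
theorem closure_schreierLanguage (hpre : IsPrefixClosed C)
    (honto : ∀ g, ∃ w ∈ C, μ (FreeGroup.mk w) = g)
    (huniq : ∀ u ∈ C, ∀ v ∈ C, μ (FreeGroup.mk u) = μ (FreeGroup.mk v) → u = v) :
    Subgroup.closure {g : FreeGroup X | ∃ w ∈ schreierLanguage μ C, FreeGroup.mk w = g} =
      μ.ker := by
  have hnil : [] ∈ C := by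
    obtain ⟨w, hw, -⟩ := honto 1
    exact hpre w hw _ List.nil_prefix
  apply le_antisymm
  · rw [Subgroup.closure_le]
    rintro _ ⟨_, ⟨u, a, v, h, rfl⟩, rfl⟩
    rw [SetLike.mem_coe, MonoidHom.mem_ker,
      show u ++ a :: FreeGroup.invRev v = (u ++ [a]) ++ FreeGroup.invRev v by simp,
      ← FreeGroup.mul_mk, ← FreeGroup.inv_mk, map_mul, map_inv, h.2.2.2.2, mul_inv_cancel]
  · set H := Subgroup.closure {g : FreeGroup X | ∃ w ∈ schreierLanguage μ C, FreeGroup.mk w = g}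
    have key : ∀ w : List (X × Bool), ∀ c ∈ C, μ (FreeGroup.mk w) = μ (FreeGroup.mk c) →
        FreeGroup.mk w * (FreeGroup.mk c)⁻¹ ∈ H := by
      intro w
      induction w using List.reverseRecOn with
      | nil =>
        intro c hc h
        obtain rfl := huniq _ hnil _ hc h
        rw [mul_inv_cancel]
        exact one_mem _
      | append_singleton w a ih =>
        intro c hc h
        obtain ⟨c₀, hc₀, h₀⟩ := honto (μ (FreeGroup.mk w))
        have h1 := ih c₀ hc₀ h₀.symm
        have h2 : μ (FreeGroup.mk (c₀ ++ [a])) = μ (FreeGroup.mk c) := by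
          rw [← h, ← FreeGroup.mul_mk, ← FreeGroup.mul_mk, map_mul, map_mul, h₀]
        have h3 : FreeGroup.mk (c₀ ++ [a]) * (FreeGroup.mk c)⁻¹ ∈ H := by
          by_cases h4 : c₀ ++ [a] ∈ C
          · rw [huniq _ h4 _ hc h2, mul_inv_cancel]
            exact one_mem _
          by_cases h5 : c ++ [invLetter a] ∈ C
          · rw [← huniq _ h5 _ hc₀ (IsSchreierTriple.map_concat_eq h2), ← FreeGroup.mul_mk,
              ← FreeGroup.mul_mk, mk_invLetter, inv_mul_cancel_right, mul_inv_cancel]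
            exact one_mem _
          · rw [FreeGroup.inv_mk, FreeGroup.mul_mk]
            refine Subgroup.subset_closure ⟨_, ⟨c₀, a, c, ⟨hc₀, hc, h4, h5, h2⟩, rfl⟩, ?_⟩
            simp
        have h6 := mul_mem h1 h3
        rwa [← FreeGroup.mul_mk, mul_assoc, mul_assoc, inv_mul_cancel_left, ← mul_assoc,
          FreeGroup.mul_mk] at h6
    intro g hg
    obtain ⟨w, rfl⟩ := Quot.exists_rep g
    have hw : μ (FreeGroup.mk w) = μ (FreeGroup.mk []) := by
      rw [← FreeGroup.one_eq_mk, map_one]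
      exact hg
    have := key w [] hnil hw
    rwa [← FreeGroup.one_eq_mk, inv_one, mul_one] at this

end Schreier

/-! ### Linearity of the language of Schreier generators -/

/-- The states of the transducer for the language of Schreier generators: an initial state, states
that simulate the multiplier automaton for `x` and a word acceptor on both tapes, where two flags
tell which tapes have been read completely, and a final state. -/
inductive SchreierState (A : Type) (σ : A → Type) (Q : Type) : Type
  | init
  | run (x : A) (s : σ x) (l r : Bool) (p q : Q)
  | final

theorem SchreierState.finite {A : Type} {σ : A → Type} {Q : Type} [Finite A] [∀ x, Finite (σ x)]
    [Finite Q] : Finite (SchreierState A σ Q) := by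
  refine Finite.of_surjective (α := Option (Option ((x : A) × σ x × Bool × Bool × Q × Q)))
    (fun o => match o with
      | none => .init
      | some none => .final
      | some (some ⟨x, s, l, r, p, q⟩) => .run x s l r p q) ?_
  rintro (_ | ⟨x, s, l, r, p, q⟩ | _)
  · exact ⟨none, rfl⟩
  · exact ⟨some (some ⟨x, s, l, r, p, q⟩), rfl⟩
  · exact ⟨some none, rfl⟩

section Transducer

variable {X : Type} {σ : X × Bool → Type} {Q : Type}

/-- The edges of the transducer for the language of Schreier generators. -/
inductive SchreierEdge (M : (x : X × Bool) → AsyncAutomaton (X × Bool) (σ x))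
    (D : DFA (X × Bool) Q) : SchreierState (X × Bool) σ Q → Option (X × Bool) →
      Option (X × Bool) → SchreierState (X × Bool) σ Q → Prop
  | init (x : X × Bool) :
      SchreierEdge M D .init none none (.run x (M x).start false false D.start D.start)
  | left {x a : X × Bool} {s t : σ x} {r : Bool} {p q : Q} : (M x).readsLeft s = true →
      (M x).step s (some a) = some t →
      SchreierEdge M D (.run x s false r p q) (some a) none (.run x t false r (D.step p a) q)
  | leftEnd {x : X × Bool} {s t : σ x} {r : Bool} {p q : Q} : (M x).readsLeft s = true →
      (M x).step s none = some t →
      SchreierEdge M D (.run x s false r p q) none none (.run x t true r p q)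
  | right {x a : X × Bool} {s t : σ x} {l : Bool} {p q : Q} : (M x).readsLeft s = false →
      (M x).step s (some a) = some t →
      SchreierEdge M D (.run x s l false p q) none (some (invLetter a))
        (.run x t l false p (D.step q a))
  | rightEnd {x : X × Bool} {s t : σ x} {l : Bool} {p q : Q} : (M x).readsLeft s = false →
      (M x).step s none = some t →
      SchreierEdge M D (.run x s l false p q) none none (.run x t l true p q)
  -- The letter `x` is written when both tapes are finished, as it stands between `u` and `v⁻¹`. The
  -- multiplier has checked that `u` and `v` are in `C`; the word acceptor is run to exclude the
  -- trivial generators.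
  | final {x : X × Bool} {s : σ x} {p q : Q} : s ∈ (M x).accept → D.step p x ∉ D.accept →
      D.step q (invLetter x) ∉ D.accept →
      SchreierEdge M D (.run x s true true p q) (some x) none .final

/-- The transducer for the language of Schreier generators. -/
def schreierTransducer (M : (x : X × Bool) → AsyncAutomaton (X × Bool) (σ x))
    (D : DFA (X × Bool) Q) : TransductionAutomaton (X × Bool) (SchreierState (X × Bool) σ Q) where
  edge := SchreierEdge M D
  start := .init
  terminal := {.final}

variable {M : (x : X × Bool) → AsyncAutomaton (X × Bool) (σ x)} {D : DFA (X × Bool) Q}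

/-- End-of-tape symbols become silent edges, so the transducer guesses where the tapes end; the
flags prevent reading past a guessed end. -/
theorem schreierTransducer_path_of_acceptsFrom {x : X × Bool} {s : σ x}
    {U V : List (Option (X × Bool))} (h : (M x).AcceptsFrom s U V) :
    ∀ (l r : Bool) (p q : Q) (u v : List (X × Bool)), U = remainingTape l u →
      V = remainingTape r v → (l = true → u = []) → (r = true → v = []) →
      D.evalFrom p (u ++ [x]) ∉ D.accept → D.evalFrom q (v ++ [invLetter x]) ∉ D.accept →
      (schreierTransducer M D).Path (.run x s l r p q) .final (u ++ [x]) (v.map invLetter) := by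
  induction h with
  | done hs =>
    intro l r p q u v hU hV hu hv h1 h2
    cases l
    · simp [remainingTape] at hU
    cases r
    · simp [remainingTape] at hV
    obtain rfl := hu rfl
    obtain rfl := hv rfl
    exact .cons (a := some x) (b := none) (SchreierEdge.final hs (by simpa using h1) (by simpa using h2)) (.nil _)
  | @left s t o U V hl hstep _ ih =>
    intro l r p q u v hU hV hu hv h1 h2
    cases l
    swap
    · simp [remainingTape] at hU
    cases u with
    | nil =>
      obtain ⟨rfl, rfl⟩ : o = none ∧ U = [] := by simpa [remainingTape] using hU
      exact .cons (a := none) (b := none) (SchreierEdge.leftEnd hl hstep)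
        (ih true r p q [] v rfl hV (by simp) hv h1 h2)
    | cons a u =>
      obtain ⟨rfl, rfl⟩ : o = some a ∧ U = remainingTape false u := by
        simpa [remainingTape] using hU
      exact .cons (a := some a) (b := none) (SchreierEdge.left hl hstep)
        (ih false r _ q u v rfl hV (by simp) hv (by simpa using h1) h2)
  | @right s t o U V hl hstep _ ih =>
    intro l r p q u v hU hV hu hv h1 h2
    cases r
    swap
    · simp [remainingTape] at hV
    cases v with
    | nil =>
      obtain ⟨rfl, rfl⟩ : o = none ∧ V = [] := by simpa [remainingTape] using hV
      exact .cons (a := none) (b := none) (SchreierEdge.rightEnd hl hstep)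
        (ih l true p q u [] hU rfl hu (by simp) h1 h2)
    | cons a v =>
      obtain ⟨rfl, rfl⟩ : o = some a ∧ V = remainingTape false v := by
        simpa [remainingTape] using hV
      exact .cons (a := none) (b := some (invLetter a)) (SchreierEdge.right hl hstep)
        (ih l false p _ u v hU rfl hu (by simp) h1 (by simpa using h2))

theorem acceptsFrom_of_schreierTransducer_path {P P' : SchreierState (X × Bool) σ Q}
    {U V : List (X × Bool)} (h : (schreierTransducer M D).Path P P' U V) :
    ∀ (x : X × Bool) (s : σ x) (l r : Bool) (p q : Q), P = .run x s l r p q → P' = .final →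
      ∃ u v, U = u ++ [x] ∧ V = v.map invLetter ∧ (l = true → u = []) ∧ (r = true → v = []) ∧
        (M x).AcceptsFrom s (remainingTape l u) (remainingTape r v) ∧
        D.evalFrom p (u ++ [x]) ∉ D.accept ∧ D.evalFrom q (v ++ [invLetter x]) ∉ D.accept := by
  induction h with
  | nil => rintro x s l r p q rfl h; cases h
  | cons he hp ih =>
    rintro x s l r p q rfl rfl
    cases he with
    | left hl hstep =>
      obtain ⟨u, v, rfl, rfl, hu, hv, hM, h1, h2⟩ := ih _ _ _ _ _ _ rfl rfl
      exact ⟨_ :: u, v, by simp, rfl, by simp, hv, .left hl hstep hM, h1, h2⟩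
    | leftEnd hl hstep =>
      obtain ⟨u, v, rfl, rfl, hu, hv, hM, h1, h2⟩ := ih _ _ _ _ _ _ rfl rfl
      obtain rfl := hu rfl
      exact ⟨[], v, by simp, rfl, by simp, hv, .left hl hstep hM, h1, h2⟩
    | right hl hstep =>
      obtain ⟨u, v, rfl, rfl, hu, hv, hM, h1, h2⟩ := ih _ _ _ _ _ _ rfl rfl
      exact ⟨u, _ :: v, by simp, by simp, hu, by simp, .right hl hstep hM, h1, h2⟩
    | rightEnd hl hstep =>
      obtain ⟨u, v, rfl, rfl, hu, hv, hM, h1, h2⟩ := ih _ _ _ _ _ _ rfl rfl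
      obtain rfl := hv rfl
      exact ⟨u, [], by simp, rfl, hu, by simp, .right hl hstep hM, h1, h2⟩
    | final hs h1 h2 =>
      cases hp with
      | nil => exact ⟨[], [], by simp, rfl, by simp, by simp, .done hs, h1, h2⟩
      | cons he _ => cases he

theorem isLinearLanguage_schreierLanguage [Finite X] {G : Type*} [Group G] {μ : FreeGroup X →* G}
    {C : Language (X × Bool)} (h : IsAsyncAutomaticStructure μ C) :
    IsLinearLanguage (schreierLanguage μ C) := by
  choose σ hσ M hM using fun x : X × Bool => h.multiplier (some x)
  obtain ⟨Q, _, D, rfl⟩ := h.regular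
  refine ⟨_, ⟨_, SchreierState.finite, schreierTransducer M D, rfl⟩, fun w => ?_⟩
  constructor
  · rintro ⟨u, x, v, ⟨hu, hv, h1, h2, h3⟩, rfl⟩
    -- The second label is the letterwise inverse of `v`, whose reversal is `v⁻¹`.
    refine ⟨u ++ [x], v.map invLetter, ⟨.final, rfl, ?_⟩, ?_⟩
    · exact .cons (a := none) (b := none) (SchreierEdge.init x)
        (schreierTransducer_path_of_acceptsFrom ((hM x u v).2 ⟨hu, hv, h3⟩) false false _ _ u v rfl
          rfl (by simp) (by simp) h1 h2)
    · rw [invRev_eq]; simp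
  · rintro ⟨U, V, ⟨q, hq, hp⟩, rfl⟩
    obtain rfl : q = .final := hq
    change (schreierTransducer M D).Path .init .final U V at hp
    cases hp with
    | cons he hp =>
      cases he with
      | init x =>
        obtain ⟨u, v, rfl, rfl, -, -, hA, h1, h2⟩ :=
          acceptsFrom_of_schreierTransducer_path hp _ _ _ _ _ _ rfl rfl
        obtain ⟨hu, hv, h3⟩ := (hM x u v).1 hA
        refine ⟨u, x, v, ⟨hu, hv, h1, h2, h3⟩, ?_⟩
        rw [invRev_eq]; simp

end Transducer

/-! ### Combination of the two directions -/

/-- A finite generating set `X`, and a linear language with significant letters that generates the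
kernel of the homomorphism from the free group on `X` to `G`. -/
def HasLinearSignificantPresentation (G : Type*) [Group G] : Prop :=
  ∃ (X : Type) (_ : Finite X) (N : Subgroup (FreeGroup X)) (_ : N.Normal)
    (L : Language (X × Bool)), Nonempty (G ≃* FreeGroup X ⧸ N) ∧
      IsLinearLanguage L ∧ HasSignificantLetters L ∧
        Subgroup.closure {g : FreeGroup X | ∃ w ∈ L, FreeGroup.mk w = g} = N

theorem IsAsyncAutomaticStructure.hasLinearSignificantPresentation {X : Type} [Finite X]
    [Nonempty X] {G : Type*} [Group G] {μ : FreeGroup X →* G} {C : Language (X × Bool)}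
    (hsurj : Function.Surjective μ) (hstr : IsAsyncAutomaticStructure μ C)
    (hpre : IsPrefixClosed C)
    (huniq : ∀ u ∈ C, ∀ v ∈ C, μ (FreeGroup.mk u) = μ (FreeGroup.mk v) → u = v) :
    HasLinearSignificantPresentation G :=
  ⟨X, inferInstance, μ.ker, inferInstance, schreierLanguage μ C,
    ⟨(QuotientGroup.quotientKerEquivOfSurjective μ hsurj).symm⟩,
    isLinearLanguage_schreierLanguage hstr, hasSignificantLetters_schreierLanguage hpre huniq,
    closure_schreierLanguage hpre hstr.onto huniq⟩

/-- Covers structures over the empty alphabet, where no default letter exists: the group is then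
trivial, and a one-letter alphabet with `C = {[]}` serves instead. -/
theorem hasLinearSignificantPresentation_unit : HasLinearSignificantPresentation Unit := by
  have hC : ∀ w ∈ ({[]} : Language (Unit × Bool)), w = [] := fun w hw => hw
  have huniq : ∀ u ∈ ({[]} : Language (Unit × Bool)), ∀ v ∈ ({[]} : Language (Unit × Bool)),
      (1 : FreeGroup Unit →* Unit) (FreeGroup.mk u) = (1 : FreeGroup Unit →* Unit) (FreeGroup.mk v) →
      u = v := fun u hu v hv _ => (hC u hu).trans (hC v hv).symm
  have hpre : IsPrefixClosed ({[]} : Language (Unit × Bool)) := fun w hw u hu => by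
    rw [hC w hw] at hu
    exact List.prefix_nil.1 hu
  have hsurj : Function.Surjective (1 : FreeGroup Unit →* Unit) := fun _ => ⟨1, rfl⟩
  refine (isAsyncAutomaticStructure_of_fellowTravel (E := Set.univ) (isRegular_of_subset_nil hC) hpre
    (fun _ => ⟨[], rfl, rfl⟩) huniq (Set.toFinite _) fun x u hu v hv _ =>
      ?_).hasLinearSignificantPresentation hsurj hpre huniq
  rw [hC u hu, hC v hv]
  exact .nil trivial

theorem HasLinearSignificantPresentation.of_subsingleton {G : Type*} [Group G] [Subsingleton G] :
    HasLinearSignificantPresentation G := by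
  obtain ⟨X, hX, N, hN, L, ⟨e⟩, h⟩ := hasLinearSignificantPresentation_unit
  have : Unique G := { default := 1, uniq := fun _ => Subsingleton.elim _ _ }
  exact ⟨X, hX, N, hN, L, ⟨(MulEquiv.ofUnique : G ≃* Unit).trans e⟩, h⟩

theorem theorem1 {G : Type*} [Group G] :
    HasPrefixClosedAsyncStructureWithUniqueness G ↔
      ∃ (X : Type) (_ : Finite X) (N : Subgroup (FreeGroup X)) (_ : N.Normal)
        (L : Language (X × Bool)),
        Nonempty (G ≃* FreeGroup X ⧸ N) ∧
          IsLinearLanguage L ∧ HasSignificantLetters L ∧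
            Subgroup.closure {g : FreeGroup X | ∃ w ∈ L, FreeGroup.mk w = g} = N := by
  constructor
  · rintro ⟨X, hX, μ, C, hsurj, hstr, hpre, huniq⟩
    rcases isEmpty_or_nonempty X with hXe | hXn
    · have : Subsingleton G := hsurj.subsingleton
      exact HasLinearSignificantPresentation.of_subsingleton
    · exact hstr.hasLinearSignificantPresentation hsurj hpre huniq
  · rintro ⟨X, hX, N, hN, L, ⟨e⟩, hlin, hsig, hcl⟩
    exact .of_mulEquiv e.symm (hsig.hasPrefixClosedAsyncStructureWithUniqueness hlin hcl)
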